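/- Let $k$ be a field of characteristic zero. All operads are nonunital symmetric operads in ($\mathbb Z$-)graded $k$-vector spaces: sequences $\mathcal S(n)$, $n\ge 1$, of graded vector spaces with linear $\Sigma_n$-actions and equivariant degree-zero partial compositions $\circ_i:\mathcal S(m)\otimes\mathcal S(n)\to\mathcal S(m+n-1)$, $1\le i\le n$ ($f\circ_i g$ inserts $f$ into the $i$-th input of $g$), satisfying the usual associativity axioms with Koszul signs. A differential on an operad is an equivariant degree $-1$ derivation $d$ with $d^2=0$, i.e. $d(f\circ_i g)=df\circ_i g+(-1)^{|f|}f\circ_i dg$. $\mathcal F(Z)$ denotes the free operad on a collection $Z=\{Z(n)\}_{n\ge2}$ of graded $\Sigma_n$-modules, and $\mathcal F^{l}(Z)$ its part spanned by words of length $l$ in the generators. If $Z=Z^0\oplus Z^1\oplus\cdots$ is a decomposition into subcollections, $\mathcal F(Z)^k$ denotes the part spanned by words whose generators have upper degrees of sum $k$, and $\mathcal F(Z)^{\le m}=\bigoplus_{k\le m}\mathcal F(Z)^k$ (which is $0$ if $m<0$). If a differential $d$ on $\mathcal F(Z)$ is homogeneous of degree $-1$ for the upper grading, its homology inherits an upper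 grading $\mathcal H^k(\mathcal F(Z),d)$. A TJ-model (bigraded model) of an operad $\mathcal H$ with $\mathcal H(1)=0$ is a collection $Z=Z^0\oplus Z^1\oplus\cdots$, a differential $d$ on $\mathcal F(Z)$ with $d(Z^0)=0$ and $d(Z^k)\subset\mathcal F(Z)^{k-1}$ for $k\ge1$, and a homomorphism $\rho:(\mathcal F(Z),d)\to(\mathcal H,0)$ of differential operads such that (a) $d(Z)\subset\mathcal F^{\ge2}(Z)$; (b) $\rho|_{Z^{\ge1}}=0$ and $\rho$ induces an isomorphism $\mathcal H^0(\mathcal F(Z),d)\cong\mathcal H$; (c) $\mathcal H^{\ge1}(\mathcal F(Z),d)=0$. **Theorem.** Let $(\mathcal S,d_{\mathcal S})$ be a differential operad with $\mathcal S(1)=0$, let $\mathcal H=\mathcal H(\mathcal S,d_{\mathcal S})$ be its homology operad, and let $\rho:(\mathcal F(Z),d)\to(\mathcal H,0)$ be a TJ-model of $\mathcal H$. Then there exist a differential $D$ on $\mathcal F(Z)$ and a homomorphism $\alpha:(\mathcal F(Z),D)\to(\mathcal S,d_{\mathcal S})$ of differential operads such that 1. $(D-d)(Z^k)\subset\mathcal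 F(Z)^{\le k-2}$ for every $k\ge0$, and 2. $\alpha$ induces an isomorphism $\mathcal H(\alpha):\mathcal H(\mathcal F(Z),D)\to\mathcal H(\mathcal S,d_{\mathcal S})$. (Such an $\alpha:(\mathcal F(Z),D)\to(\mathcal S,d_{\mathcal S})$ is called a filtered model of $(\mathcal S,d_{\mathcal S})$.) -/

import Mathlib

/-!
Nonunital differential graded operads over a field, the free operad, homology operads, bigraded
(Tate–Jozefiak) models.

Conventions.  An arity `m ≥ 1` is encoded by the natural number `m - 1`: the component `obj n p` of
a collection is its part of arity `n + 1` and inner degree `p : ℤ`, on which the symmetric group of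
`Fin (n + 1)` acts from the left.  Inputs are numbered from `0`.  A graded vector space is the
family of its homogeneous parts.  Operations depending on an equation between arities or degrees
take the equation as an argument, so that no transport along equalities is needed.
-/

universe u v w

namespace OperadModels

/-- The sign `(-1)^n` in the field `k`. -/
def sgn (k : Type u) [Field k] (n : ℤ) : k := ((n.negOnePow : ℤ) : k)

section Permutations

/-- Replacing the input `i` of an operation with `b + 1` inputs by an operation with `a + 1` inputs
gives an operation with `c + 1 = a + b + 1` inputs.  These are the inputs of the inserted
operation (the block `i, …, i + a`) together with the inputs `s ≠ i` of the outer operation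
(`s < i` keeps its number, `s > i` becomes `s + a`). -/
def blockFun {a b c : ℕ} (h : a + b = c) (i : Fin (b + 1)) :
    Fin (a + 1) ⊕ {s : Fin (b + 1) // s ≠ i} → Fin (c + 1) :=
  Sum.elim (fun t => ⟨i.1 + t.1, by omega⟩)
    (fun s => if s.1.1 < i.1 then ⟨s.1.1, by omega⟩ else ⟨s.1.1 + a, by omega⟩)

theorem blockFun_bijective {a b c : ℕ} (h : a + b = c) (i : Fin (b + 1)) :
    Function.Bijective (blockFun h i) := by
  rw [Fintype.bijective_iff_injective_and_card]
  constructor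
  · rintro (t | ⟨s, hs⟩) (t' | ⟨s', hs'⟩) hx
    · simp only [blockFun, Sum.elim_inl, Fin.mk.injEq] at hx
      congr 1
      ext
      omega
    · exfalso
      have hs'' : s'.1 ≠ i.1 := fun e => hs' (Fin.ext e)
      simp only [blockFun, Sum.elim_inl, Sum.elim_inr] at hx
      split_ifs at hx <;> simp only [Fin.mk.injEq] at hx <;> omega
    · exfalso
      have hs'' : s.1 ≠ i.1 := fun e => hs (Fin.ext e)
      simp only [blockFun, Sum.elim_inl, Sum.elim_inr] at hx
      split_ifs at hx <;> simp only [Fin.mk.injEq] at hx <;> omega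
    · have hs1 : s.1 ≠ i.1 := fun e => hs (Fin.ext e)
      have hs2 : s'.1 ≠ i.1 := fun e => hs' (Fin.ext e)
      simp only [blockFun, Sum.elim_inr] at hx
      congr 1
      apply Subtype.ext
      ext
      show s.1 = s'.1
      split_ifs at hx <;> simp only [Fin.mk.injEq] at hx <;> omega
  · simp only [Fintype.card_sum, Fintype.card_fin, Fintype.card_subtype_compl,
      Fintype.card_unique]
    omega

/-- `blockFun` as an equivalence. -/
noncomputable def blockEquiv {a b c : ℕ} (h : a + b = c) (i : Fin (b + 1)) :
    Fin (a + 1) ⊕ {s : Fin (b + 1) // s ≠ i} ≃ Fin (c + 1) :=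
  Equiv.ofBijective (blockFun h i) (blockFun_bijective h i)

/-- The permutation obtained by inserting `σ` at the place `i` in `τ`: it carries the block of
inputs at the place `τ⁻¹ i` to the block at the place `i` by `σ`, and the remaining inputs as `τ`
does. -/
noncomputable def insertPerm {a b c : ℕ} (h : a + b = c) (σ : Equiv.Perm (Fin (a + 1)))
    (τ : Equiv.Perm (Fin (b + 1))) (i : Fin (b + 1)) : Equiv.Perm (Fin (c + 1)) :=
  (blockEquiv h (τ⁻¹ i)).symm.trans
    ((Equiv.sumCongr σ
      (τ.subtypeEquiv fun s => not_congr (by rw [Equiv.Perm.eq_inv_iff_eq]))).trans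
        (blockEquiv h i))

end Permutations

/-- Sequences of graded vector spaces `E(n)`, `n ≥ 1`, with linear degree-preserving left actions
of the symmetric groups. -/
structure Collection (k : Type u) [Field k] : Type (max u (v + 1)) where
  /-- the part of arity `n + 1` and inner degree `p` -/
  obj : ℕ → ℤ → Type v
  [addCommGroup : ∀ n p, AddCommGroup (obj n p)]
  [module : ∀ n p, Module k (obj n p)]
  /-- the action of the symmetric group -/
  act : ∀ n p, Representation k (Equiv.Perm (Fin (n + 1))) (obj n p)

attribute [instance] Collection.addCommGroup Collection.module

/-- `E(1) = 0`. -/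
def Collection.Reduced {k : Type u} [Field k] (E : Collection.{u, v} k) : Prop :=
  ∀ p, Subsingleton (E.obj 0 p)

/-- A decomposition `E = E^0 ⊕ E^1 ⊕ ⋯` into invariant graded subspaces; `piece j` is `E^j`. -/
structure Collection.Decomposition {k : Type u} [Field k] (E : Collection.{u, v} k) where
  /-- the summand `E^j` -/
  piece : ℕ → ∀ n p, Submodule k (E.obj n p)
  act_mem : ∀ j n p (σ : Equiv.Perm (Fin (n + 1))), ∀ x ∈ piece j n p,
    E.act n p σ x ∈ piece j n p
  isInternal : ∀ n p, DirectSum.IsInternal fun j => piece j n p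

/-- A nonunital (graded, symmetric) operad.  `circ _ i _ f g` is `f ∘ᵢ g`, the operation in which
`f` is inserted into the input `i` of `g`. -/
structure Operad (k : Type u) [Field k] : Type (max u (v + 1)) extends Collection.{u, v} k where
  /-- the composition `f ∘ᵢ g` -/
  circ : ∀ {a b c : ℕ} (_ : a + b = c) (_ : Fin (b + 1)) {p q r : ℤ} (_ : p + q = r),
    obj a p →ₗ[k] obj b q →ₗ[k] obj c r
  /-- `f ∘ᵢ₊ⱼ (g ∘ⱼ h) = (f ∘ᵢ g) ∘ⱼ h` for an input `i` of `g` and an input `j` of `h` -/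
  assoc_nested : ∀ {a b c ab bc abc : ℕ} (hab : a + b = ab) (hbc : b + c = bc)
    (h₁ : a + bc = abc) (h₂ : ab + c = abc) {p q r pq qr pqr : ℤ} (hpq : p + q = pq)
    (hqr : q + r = qr) (h₃ : p + qr = pqr) (h₄ : pq + r = pqr)
    (i : Fin (b + 1)) (j : Fin (c + 1)) (f : obj a p) (g : obj b q) (h : obj c r),
    circ h₁ ⟨i.1 + j.1, by omega⟩ h₃ f (circ hbc j hqr g h) =
      circ h₂ j h₄ (circ hab i hpq f g) h
  /-- `f ∘ᵢ (g ∘ⱼ h) = (-1)^(|f||g|) g ∘ⱼ₊ₐ (f ∘ᵢ h)` for inputs `i < j` of `h`, where `f` has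
  `a + 1` inputs.  (The case of inputs `i > j` of `h` is this equation with `f`, `g` exchanged.) -/
  assoc_parallel : ∀ {a b c ac bc abc : ℕ} (hac : a + c = ac) (hbc : b + c = bc)
    (h₁ : a + bc = abc) (h₂ : b + ac = abc) {p q r pr qr pqr : ℤ} (hpr : p + r = pr)
    (hqr : q + r = qr) (h₃ : p + qr = pqr) (h₄ : q + pr = pqr)
    (i j : Fin (c + 1)) (_ : i < j) (f : obj a p) (g : obj b q) (h : obj c r),
    circ h₁ ⟨i.1, by omega⟩ h₃ f (circ hbc j hqr g h) =
      sgn k (p * q) • circ h₂ ⟨j.1 + a, by omega⟩ h₄ g (circ hac i hpr f h)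
  /-- the compositions are equivariant -/
  circ_act : ∀ {a b c : ℕ} (h : a + b = c) (i : Fin (b + 1)) {p q r : ℤ} (hr : p + q = r)
    (σ : Equiv.Perm (Fin (a + 1))) (τ : Equiv.Perm (Fin (b + 1))) (f : obj a p) (g : obj b q),
    circ h i hr (act a p σ f) (act b q τ g) =
      act c r (insertPerm h σ τ i) (circ h (τ⁻¹ i) hr f g)

/-- Homomorphisms of operads. -/
structure Operad.Hom {k : Type u} [Field k] (S : Operad.{u, v} k) (T : Operad.{u, w} k) where
  /-- the components -/
  map : ∀ n p, S.obj n p →ₗ[k] T.obj n p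
  map_act : ∀ n p (σ : Equiv.Perm (Fin (n + 1))) (x : S.obj n p),
    map n p (S.act n p σ x) = T.act n p σ (map n p x)
  map_circ : ∀ {a b c : ℕ} (h : a + b = c) (i : Fin (b + 1)) {p q r : ℤ} (hr : p + q = r)
    (f : S.obj a p) (g : S.obj b q),
    map c r (S.circ h i hr f g) = T.circ h i hr (map a p f) (map b q g)

/-- A differential on an operad: a derivation of degree `-1` and square zero. -/
structure Operad.Differential {k : Type u} [Field k] (S : Operad.{u, v} k) where
  /-- the components, from degree `p` to degree `q = p - 1` -/
  d : ∀ n p q, q + 1 = p → (S.obj n p →ₗ[k] S.obj n q)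
  d_act : ∀ n p q (h : q + 1 = p) (σ : Equiv.Perm (Fin (n + 1))) (x : S.obj n p),
    d n p q h (S.act n p σ x) = S.act n q σ (d n p q h x)
  d_circ : ∀ {a b c : ℕ} (h : a + b = c) (i : Fin (b + 1)) {p q r p' q' r' : ℤ} (hr : p + q = r)
    (hp : p' + 1 = p) (hq : q' + 1 = q) (hr' : r' + 1 = r) (f : S.obj a p) (g : S.obj b q),
    d c r r' hr' (S.circ h i hr f g) =
      S.circ h i (by omega) (d a p p' hp f) g +
        sgn k p • S.circ h i (by omega) f (d b q q' hq g)
  d_d : ∀ n p q r (hq : q + 1 = p) (hr : r + 1 = q) (x : S.obj n p),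
    d n q r hr (d n p q hq x) = 0

/-- The trivial differential. -/
def Operad.zeroDifferential {k : Type u} [Field k] (S : Operad.{u, v} k) : S.Differential where
  d _ _ _ _ := 0
  d_act := by simp
  d_circ := by simp
  d_d := by simp

/-- Homomorphisms `(S, dS) → (T, dT)` of differential operads. -/
structure DGHom {k : Type u} [Field k] {S : Operad.{u, v} k} {T : Operad.{u, w} k}
    (dS : S.Differential) (dT : T.Differential) extends Operad.Hom S T where
  map_d : ∀ n p q (h : q + 1 = p) (x : S.obj n p),
    map n q (dS.d n p q h x) = dT.d n p q h (map n p x)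

section Homology

variable {k : Type u} [Field k] {S : Operad.{u, v} k} (d : S.Differential)

/-- The cycles of arity `n + 1` and degree `p`. -/
def Operad.Differential.cycles (n : ℕ) (p : ℤ) : Submodule k (S.obj n p) :=
  LinearMap.ker (d.d n p (p - 1) (by omega))

/-- The boundaries of arity `n + 1` and degree `p`, as a subspace of the cycles. -/
def Operad.Differential.boundaries (n : ℕ) (p : ℤ) : Submodule k (d.cycles n p) :=
  (LinearMap.range (d.d n (p + 1) p rfl)).comap (d.cycles n p).subtype

theorem Operad.Differential.mem_cycles {n : ℕ} {p : ℤ} {x : S.obj n p} :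
    x ∈ d.cycles n p ↔ ∀ q (h : q + 1 = p), d.d n p q h x = 0 := by
  constructor
  · intro hx q h
    obtain rfl : q = p - 1 := by omega
    exact hx
  · intro hx
    exact hx _ _

theorem Operad.Differential.mem_boundaries {n : ℕ} {p : ℤ} {x : d.cycles n p} :
    x ∈ d.boundaries n p ↔ ∃ y, d.d n (p + 1) p rfl y = x.1 := Iff.rfl

theorem Operad.Differential.act_mem_cycles {n : ℕ} {p : ℤ} (σ : Equiv.Perm (Fin (n + 1)))
    (x : S.obj n p) (hx : x ∈ d.cycles n p) : S.act n p σ x ∈ d.cycles n p := by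
  rw [d.mem_cycles] at hx ⊢
  intro q h
  rw [d.d_act, hx q h, map_zero]

theorem Operad.Differential.circ_mem_cycles {a b c : ℕ} (h : a + b = c) (i : Fin (b + 1))
    {p q r : ℤ} (hr : p + q = r) {x : S.obj a p} (hx : x ∈ d.cycles a p) {y : S.obj b q}
    (hy : y ∈ d.cycles b q) : S.circ h i hr x y ∈ d.cycles c r := by
  rw [d.mem_cycles] at hx hy ⊢
  intro r' h'
  rw [d.d_circ h i hr (p' := p - 1) (q' := q - 1) (by omega) (by omega) h', hx, hy]
  simp

/-- The vector space `ker d / im d` in arity `n + 1` and degree `p`. -/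
abbrev Operad.Differential.HomologyObj (n : ℕ) (p : ℤ) : Type v :=
  d.cycles n p ⧸ d.boundaries n p

/-- The action of the symmetric group on cycles. -/
def Operad.Differential.cyclesAct (n : ℕ) (p : ℤ) (σ : Equiv.Perm (Fin (n + 1))) :
    d.cycles n p →ₗ[k] d.cycles n p :=
  (S.act n p σ).restrict (d.act_mem_cycles σ)

theorem Operad.Differential.boundaries_le_comap_act (n : ℕ) (p : ℤ)
    (σ : Equiv.Perm (Fin (n + 1))) :
    d.boundaries n p ≤ (d.boundaries n p).comap (d.cyclesAct n p σ) := by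
  rintro x ⟨y, hy⟩
  exact ⟨S.act n (p + 1) σ y, by rw [d.d_act, hy]; rfl⟩

/-- The action of the symmetric group on homology. -/
def Operad.Differential.homologyAct (n : ℕ) (p : ℤ) :
    Representation k (Equiv.Perm (Fin (n + 1))) (d.HomologyObj n p) where
  toFun σ := (d.boundaries n p).mapQ (d.boundaries n p) (d.cyclesAct n p σ)
    (d.boundaries_le_comap_act n p σ)
  map_one' := by
    apply Submodule.linearMap_qext
    ext x
    simp [Operad.Differential.cyclesAct, LinearMap.restrict_apply]
  map_mul' σ τ := by
    apply Submodule.linearMap_qext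
    ext x
    simp [Operad.Differential.cyclesAct, LinearMap.restrict_apply]

/-- The composition of cycles, with values in homology. -/
def Operad.Differential.cyclesCirc {a b c : ℕ} (h : a + b = c) (i : Fin (b + 1))
    {p q r : ℤ} (hr : p + q = r) :
    d.cycles a p →ₗ[k] d.cycles b q →ₗ[k] d.HomologyObj c r :=
  LinearMap.mk₂ k
    (fun x y => (d.boundaries c r).mkQ ⟨S.circ h i hr x y, d.circ_mem_cycles h i hr x.2 y.2⟩)
    (fun x x' y => by rw [← map_add]; congr 1; ext; simp)
    (fun t x y => by rw [← map_smul]; congr 1; ext; simp)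
    (fun x y y' => by rw [← map_add]; congr 1; ext; simp)
    (fun t x y => by rw [← map_smul]; congr 1; ext; simp)

theorem Operad.Differential.cyclesCirc_left {a b c : ℕ} (h : a + b = c) (i : Fin (b + 1))
    {p q r : ℤ} (hr : p + q = r) (x : d.cycles a p) (hx : x ∈ d.boundaries a p)
    (y : d.cycles b q) : d.cyclesCirc h i hr x y = 0 := by
  obtain ⟨z, hz⟩ := hx
  refine (Submodule.Quotient.mk_eq_zero _).2 ⟨S.circ h i (by omega) z y.1, ?_⟩
  rw [d.d_circ h i (p := p + 1) (q := q) (p' := p) (q' := q - 1) (by omega) rfl (by omega) rfl,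
    (d.mem_cycles.1 y.2) _ _, hz]
  simp

theorem Operad.Differential.cyclesCirc_right {a b c : ℕ} (h : a + b = c) (i : Fin (b + 1))
    {p q r : ℤ} (hr : p + q = r) (x : d.cycles a p) (y : d.cycles b q)
    (hy : y ∈ d.boundaries b q) : d.cyclesCirc h i hr x y = 0 := by
  obtain ⟨z, hz⟩ := hy
  refine (Submodule.Quotient.mk_eq_zero _).2 ⟨sgn k p • S.circ h i (by omega) x.1 z, ?_⟩
  rw [map_smul, d.d_circ h i (p := p) (q := q + 1) (p' := p - 1) (q' := q) (by omega) (by omega)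
    rfl rfl, (d.mem_cycles.1 x.2) _ _, hz]
  have hs : sgn k p * sgn k p = 1 := by
    unfold sgn
    rw [← Int.cast_mul, ← Units.val_mul]
    simp
  simp [smul_smul, hs]

/-- The composition in homology. -/
def Operad.Differential.homologyCirc {a b c : ℕ} (h : a + b = c) (i : Fin (b + 1))
    {p q r : ℤ} (hr : p + q = r) :
    d.HomologyObj a p →ₗ[k] d.HomologyObj b q →ₗ[k] d.HomologyObj c r :=
  (d.boundaries a p).liftQ
    { toFun := fun x => (d.boundaries b q).liftQ (d.cyclesCirc h i hr x)
        (fun y hy => d.cyclesCirc_right h i hr x y hy)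
      map_add' := fun x x' => by
        apply Submodule.linearMap_qext
        ext y
        exact LinearMap.congr_fun (map_add (d.cyclesCirc h i hr) x x') y
      map_smul' := fun t x => by
        apply Submodule.linearMap_qext
        ext y
        exact LinearMap.congr_fun (map_smul (d.cyclesCirc h i hr) t x) y }
    (fun x hx => by
      apply Submodule.linearMap_qext
      ext y
      exact d.cyclesCirc_left h i hr x hx y)

/-- The homology operad `H(S, d)`. -/
def Operad.Differential.homology : Operad.{u, v} k where
  obj n p := d.HomologyObj n p
  act := d.homologyAct
  circ := d.homologyCirc
  assoc_nested := by
    intro a b c ab bc abc hab hbc h₁ h₂ p q r pq qr pqr hpq hqr h₃ h₄ i j f g h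
    obtain ⟨f, rfl⟩ := Submodule.Quotient.mk_surjective _ f
    obtain ⟨g, rfl⟩ := Submodule.Quotient.mk_surjective _ g
    obtain ⟨h, rfl⟩ := Submodule.Quotient.mk_surjective _ h
    refine congrArg (d.boundaries abc pqr).mkQ (Subtype.ext ?_)
    exact S.assoc_nested hab hbc h₁ h₂ hpq hqr h₃ h₄ i j f.1 g.1 h.1
  assoc_parallel := by
    intro a b c ac bc abc hac hbc h₁ h₂ p q r pr qr pqr hpr hqr h₃ h₄ i j hij f g h
    obtain ⟨f, rfl⟩ := Submodule.Quotient.mk_surjective _ f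
    obtain ⟨g, rfl⟩ := Submodule.Quotient.mk_surjective _ g
    obtain ⟨h, rfl⟩ := Submodule.Quotient.mk_surjective _ h
    refine congrArg (d.boundaries abc pqr).mkQ (Subtype.ext ?_)
    exact S.assoc_parallel hac hbc h₁ h₂ hpr hqr h₃ h₄ i j hij f.1 g.1 h.1
  circ_act := by
    intro a b c h i p q r hr σ τ f g
    obtain ⟨f, rfl⟩ := Submodule.Quotient.mk_surjective _ f
    obtain ⟨g, rfl⟩ := Submodule.Quotient.mk_surjective _ g
    refine congrArg (d.boundaries c r).mkQ (Subtype.ext ?_)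
    exact S.circ_act h i hr σ τ f.1 g.1

/-- The homology class of a cycle. -/
def Operad.Differential.cl (n : ℕ) (p : ℤ) : d.cycles n p →ₗ[k] d.homology.obj n p :=
  (d.boundaries n p).mkQ

end Homology

section HomologyHom

variable {k : Type u} [Field k] {S : Operad.{u, v} k} {T : Operad.{u, w} k}
  {dS : S.Differential} {dT : T.Differential} (φ : DGHom dS dT)

theorem DGHom.map_mem_cycles (n : ℕ) (p : ℤ) (x : S.obj n p) (hx : x ∈ dS.cycles n p) :
    φ.map n p x ∈ dT.cycles n p := by
  rw [dT.mem_cycles]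
  intro q h
  rw [← φ.map_d, (dS.mem_cycles.1 hx) q h, map_zero]

/-- The map induced on cycles. -/
def DGHom.cyclesMap (n : ℕ) (p : ℤ) : dS.cycles n p →ₗ[k] dT.cycles n p :=
  (φ.map n p).restrict (φ.map_mem_cycles n p)

theorem DGHom.boundaries_le_comap (n : ℕ) (p : ℤ) :
    dS.boundaries n p ≤ (dT.boundaries n p).comap (φ.cyclesMap n p) := by
  rintro x ⟨y, hy⟩
  exact ⟨φ.map n (p + 1) y, by rw [← φ.map_d, hy]; rfl⟩

/-- The homomorphism `H(φ) : H(S, dS) → H(T, dT)` of homology operads. -/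
def DGHom.homologyHom : Operad.Hom dS.homology dT.homology where
  map n p := (dS.boundaries n p).mapQ (dT.boundaries n p) (φ.cyclesMap n p)
    (φ.boundaries_le_comap n p)
  map_act := by
    intro n p σ x
    obtain ⟨x, rfl⟩ := Submodule.Quotient.mk_surjective _ x
    exact congrArg (dT.boundaries n p).mkQ (Subtype.ext (φ.map_act n p σ x.1))
  map_circ := by
    intro a b c h i p q r hr f g
    obtain ⟨f, rfl⟩ := Submodule.Quotient.mk_surjective _ f
    obtain ⟨g, rfl⟩ := Submodule.Quotient.mk_surjective _ g
    exact congrArg (dT.boundaries c r).mkQ (Subtype.ext (φ.map_circ h i hr f.1 g.1))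

end HomologyHom

section Free

variable {k : Type u} [Field k] (E : Collection.{u, v} k)

/-- Formal expressions in elements of the collection `E` and the operations of an operad. -/
inductive Pre : ℕ → ℤ → Type (max u v)
  | of {n : ℕ} {p : ℤ} (e : E.obj n p) : Pre n p
  | zero {n : ℕ} {p : ℤ} : Pre n p
  | add {n : ℕ} {p : ℤ} (x y : Pre n p) : Pre n p
  | smul {n : ℕ} {p : ℤ} (t : k) (x : Pre n p) : Pre n p
  | act {n : ℕ} {p : ℤ} (σ : Equiv.Perm (Fin (n + 1))) (x : Pre n p) : Pre n p
  | circ {a b c : ℕ} (h : a + b = c) (i : Fin (b + 1)) {p q r : ℤ} (hr : p + q = r)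
      (x : Pre a p) (y : Pre b q) : Pre c r

/-- The congruence on formal expressions generated by the linear and equivariant structure of `E`
and the axioms of an operad. -/
inductive Rel : ∀ {n : ℕ} {p : ℤ}, Pre E n p → Pre E n p → Prop
  | refl {n : ℕ} {p : ℤ} (x : Pre E n p) : Rel x x
  | symm {n : ℕ} {p : ℤ} {x y : Pre E n p} : Rel x y → Rel y x
  | trans {n : ℕ} {p : ℤ} {x y z : Pre E n p} : Rel x y → Rel y z → Rel x z
  | add_congr {n : ℕ} {p : ℤ} {x x' y y' : Pre E n p} :
      Rel x x' → Rel y y' → Rel (.add x y) (.add x' y')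
  | smul_congr {n : ℕ} {p : ℤ} (t : k) {x x' : Pre E n p} :
      Rel x x' → Rel (.smul t x) (.smul t x')
  | act_congr {n : ℕ} {p : ℤ} (σ : Equiv.Perm (Fin (n + 1))) {x x' : Pre E n p} :
      Rel x x' → Rel (.act σ x) (.act σ x')
  | circ_congr {a b c : ℕ} (h : a + b = c) (i : Fin (b + 1)) {p q r : ℤ} (hr : p + q = r)
      {x x' : Pre E a p} {y y' : Pre E b q} :
      Rel x x' → Rel y y' → Rel (.circ h i hr x y) (.circ h i hr x' y')
  | add_assoc {n : ℕ} {p : ℤ} (x y z : Pre E n p) :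
      Rel (.add (.add x y) z) (.add x (.add y z))
  | add_comm {n : ℕ} {p : ℤ} (x y : Pre E n p) : Rel (.add x y) (.add y x)
  | zero_add {n : ℕ} {p : ℤ} (x : Pre E n p) : Rel (.add .zero x) x
  | smul_add {n : ℕ} {p : ℤ} (t : k) (x y : Pre E n p) :
      Rel (.smul t (.add x y)) (.add (.smul t x) (.smul t y))
  | add_smul {n : ℕ} {p : ℤ} (s t : k) (x : Pre E n p) :
      Rel (.smul (s + t) x) (.add (.smul s x) (.smul t x))
  | mul_smul {n : ℕ} {p : ℤ} (s t : k) (x : Pre E n p) :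
      Rel (.smul (s * t) x) (.smul s (.smul t x))
  | one_smul {n : ℕ} {p : ℤ} (x : Pre E n p) : Rel (.smul 1 x) x
  | zero_smul {n : ℕ} {p : ℤ} (x : Pre E n p) : Rel (.smul 0 x) .zero
  | of_add {n : ℕ} {p : ℤ} (e e' : E.obj n p) : Rel (.of (e + e')) (.add (.of e) (.of e'))
  | of_smul {n : ℕ} {p : ℤ} (t : k) (e : E.obj n p) : Rel (.of (t • e)) (.smul t (.of e))
  | of_act {n : ℕ} {p : ℤ} (σ : Equiv.Perm (Fin (n + 1))) (e : E.obj n p) :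
      Rel (.of (E.act n p σ e)) (.act σ (.of e))
  | act_add {n : ℕ} {p : ℤ} (σ : Equiv.Perm (Fin (n + 1))) (x y : Pre E n p) :
      Rel (.act σ (.add x y)) (.add (.act σ x) (.act σ y))
  | act_smul {n : ℕ} {p : ℤ} (σ : Equiv.Perm (Fin (n + 1))) (t : k) (x : Pre E n p) :
      Rel (.act σ (.smul t x)) (.smul t (.act σ x))
  | act_one {n : ℕ} {p : ℤ} (x : Pre E n p) : Rel (.act 1 x) x
  | act_mul {n : ℕ} {p : ℤ} (σ τ : Equiv.Perm (Fin (n + 1))) (x : Pre E n p) :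
      Rel (.act (σ * τ) x) (.act σ (.act τ x))
  | add_circ {a b c : ℕ} (h : a + b = c) (i : Fin (b + 1)) {p q r : ℤ} (hr : p + q = r)
      (x x' : Pre E a p) (y : Pre E b q) :
      Rel (.circ h i hr (.add x x') y) (.add (.circ h i hr x y) (.circ h i hr x' y))
  | smul_circ {a b c : ℕ} (h : a + b = c) (i : Fin (b + 1)) {p q r : ℤ} (hr : p + q = r)
      (t : k) (x : Pre E a p) (y : Pre E b q) :
      Rel (.circ h i hr (.smul t x) y) (.smul t (.circ h i hr x y))
  | circ_add {a b c : ℕ} (h : a + b = c) (i : Fin (b + 1)) {p q r : ℤ} (hr : p + q = r)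
      (x : Pre E a p) (y y' : Pre E b q) :
      Rel (.circ h i hr x (.add y y')) (.add (.circ h i hr x y) (.circ h i hr x y'))
  | circ_smul {a b c : ℕ} (h : a + b = c) (i : Fin (b + 1)) {p q r : ℤ} (hr : p + q = r)
      (t : k) (x : Pre E a p) (y : Pre E b q) :
      Rel (.circ h i hr x (.smul t y)) (.smul t (.circ h i hr x y))
  | assoc_nested {a b c ab bc abc : ℕ} (hab : a + b = ab) (hbc : b + c = bc)
      (h₁ : a + bc = abc) (h₂ : ab + c = abc) {p q r pq qr pqr : ℤ} (hpq : p + q = pq)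
      (hqr : q + r = qr) (h₃ : p + qr = pqr) (h₄ : pq + r = pqr)
      (i : Fin (b + 1)) (j : Fin (c + 1)) (f : Pre E a p) (g : Pre E b q) (h : Pre E c r) :
      Rel (.circ h₁ ⟨i.1 + j.1, by omega⟩ h₃ f (.circ hbc j hqr g h))
        (.circ h₂ j h₄ (.circ hab i hpq f g) h)
  | assoc_parallel {a b c ac bc abc : ℕ} (hac : a + c = ac) (hbc : b + c = bc)
      (h₁ : a + bc = abc) (h₂ : b + ac = abc) {p q r pr qr pqr : ℤ} (hpr : p + r = pr)
      (hqr : q + r = qr) (h₃ : p + qr = pqr) (h₄ : q + pr = pqr)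
      (i j : Fin (c + 1)) (hij : i < j) (f : Pre E a p) (g : Pre E b q) (h : Pre E c r) :
      Rel (.circ h₁ ⟨i.1, by omega⟩ h₃ f (.circ hbc j hqr g h))
        (.smul (sgn k (p * q)) (.circ h₂ ⟨j.1 + a, by omega⟩ h₄ g (.circ hac i hpr f h)))
  | circ_act {a b c : ℕ} (h : a + b = c) (i : Fin (b + 1)) {p q r : ℤ} (hr : p + q = r)
      (σ : Equiv.Perm (Fin (a + 1))) (τ : Equiv.Perm (Fin (b + 1)))
      (f : Pre E a p) (g : Pre E b q) :
      Rel (.circ h i hr (.act σ f) (.act τ g))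
        (.act (insertPerm h σ τ i) (.circ h (τ⁻¹ i) hr f g))

/-- The congruence as a setoid. -/
def preSetoid (n : ℕ) (p : ℤ) : Setoid (Pre E n p) :=
  ⟨Rel E, Rel.refl, Rel.symm, Rel.trans⟩

/-- The part of arity `n + 1` and degree `p` of the free operad on `E`. -/
def FreeObj (n : ℕ) (p : ℤ) : Type (max u v) := Quotient (preSetoid E n p)

namespace FreeObj

variable {E} {n : ℕ} {p : ℤ}

/-- The class of a formal expression. -/
def mk (x : Pre E n p) : FreeObj E n p := Quotient.mk (preSetoid E n p) x

theorem sound {x y : Pre E n p} (h : Rel E x y) : mk x = mk y := Quotient.sound h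

theorem mk_surjective (x : FreeObj E n p) : ∃ y, mk y = x := Quotient.exists_rep x

instance : Add (FreeObj E n p) :=
  ⟨Quotient.map₂ Pre.add fun _ _ h _ _ h' => Rel.add_congr h h'⟩

instance : Zero (FreeObj E n p) := ⟨mk Pre.zero⟩

instance : SMul k (FreeObj E n p) :=
  ⟨fun t => Quotient.map (Pre.smul t) fun _ _ h => Rel.smul_congr t h⟩

instance : AddCommMonoid (FreeObj E n p) where
  add_assoc x y z := by
    obtain ⟨x, rfl⟩ := mk_surjective x
    obtain ⟨y, rfl⟩ := mk_surjective y
    obtain ⟨z, rfl⟩ := mk_surjective z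
    exact sound (Rel.add_assoc x y z)
  add_comm x y := by
    obtain ⟨x, rfl⟩ := mk_surjective x
    obtain ⟨y, rfl⟩ := mk_surjective y
    exact sound (Rel.add_comm x y)
  zero_add x := by
    obtain ⟨x, rfl⟩ := mk_surjective x
    exact sound (Rel.zero_add x)
  add_zero x := by
    obtain ⟨x, rfl⟩ := mk_surjective x
    exact sound ((Rel.add_comm _ _).trans (Rel.zero_add x))
  nsmul := nsmulRec

instance instModule : Module k (FreeObj E n p) where
  one_smul x := by
    obtain ⟨x, rfl⟩ := mk_surjective x
    exact sound (Rel.one_smul x)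
  mul_smul s t x := by
    obtain ⟨x, rfl⟩ := mk_surjective x
    exact sound (Rel.mul_smul s t x)
  smul_add t x y := by
    obtain ⟨x, rfl⟩ := mk_surjective x
    obtain ⟨y, rfl⟩ := mk_surjective y
    exact sound (Rel.smul_add t x y)
  add_smul s t x := by
    obtain ⟨x, rfl⟩ := mk_surjective x
    exact sound (Rel.add_smul s t x)
  zero_smul x := by
    obtain ⟨x, rfl⟩ := mk_surjective x
    exact sound (Rel.zero_smul x)
  smul_zero t := by
    refine sound (Rel.trans (Rel.smul_congr t (Rel.zero_smul Pre.zero).symm) ?_)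
    refine Rel.trans (Rel.mul_smul t 0 _).symm ?_
    rw [mul_zero]
    exact Rel.zero_smul _

instance : Neg (FreeObj E n p) := ⟨fun x => (-1 : k) • x⟩

instance : AddCommGroup (FreeObj E n p) :=
  { (inferInstance : AddCommMonoid (FreeObj E n p)) with
    zsmul := zsmulRec
    neg_add_cancel := fun x => by
      show (-1 : k) • x + x = 0
      nth_rewrite 2 [← one_smul k x]
      rw [← add_smul, neg_add_cancel, zero_smul] }

end FreeObj

/-- The action of the symmetric group on the free operad. -/
def freeAct (n : ℕ) (p : ℤ) :
    Representation k (Equiv.Perm (Fin (n + 1))) (FreeObj E n p) where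
  toFun σ :=
    { toFun := Quotient.map (Pre.act σ) fun _ _ h => Rel.act_congr σ h
      map_add' := fun x y => by
        obtain ⟨x, rfl⟩ := FreeObj.mk_surjective x
        obtain ⟨y, rfl⟩ := FreeObj.mk_surjective y
        exact FreeObj.sound (Rel.act_add σ x y)
      map_smul' := fun t x => by
        obtain ⟨x, rfl⟩ := FreeObj.mk_surjective x
        exact FreeObj.sound (Rel.act_smul σ t x) }
  map_one' := by
    ext x
    obtain ⟨x, rfl⟩ := FreeObj.mk_surjective x
    exact FreeObj.sound (Rel.act_one x)
  map_mul' σ τ := by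
    ext x
    obtain ⟨x, rfl⟩ := FreeObj.mk_surjective x
    exact FreeObj.sound (Rel.act_mul σ τ x)

/-- The composition of the free operad. -/
def freeCirc {a b c : ℕ} (h : a + b = c) (i : Fin (b + 1)) {p q r : ℤ} (hr : p + q = r) :
    FreeObj E a p →ₗ[k] FreeObj E b q →ₗ[k] FreeObj E c r :=
  LinearMap.mk₂ k
    (Quotient.map₂ (Pre.circ h i hr) fun _ _ h₁ _ _ h₂ => Rel.circ_congr h i hr h₁ h₂)
    (fun x x' y => by
      obtain ⟨x, rfl⟩ := FreeObj.mk_surjective x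
      obtain ⟨x', rfl⟩ := FreeObj.mk_surjective x'
      obtain ⟨y, rfl⟩ := FreeObj.mk_surjective y
      exact FreeObj.sound (Rel.add_circ h i hr x x' y))
    (fun t x y => by
      obtain ⟨x, rfl⟩ := FreeObj.mk_surjective x
      obtain ⟨y, rfl⟩ := FreeObj.mk_surjective y
      exact FreeObj.sound (Rel.smul_circ h i hr t x y))
    (fun x y y' => by
      obtain ⟨x, rfl⟩ := FreeObj.mk_surjective x
      obtain ⟨y, rfl⟩ := FreeObj.mk_surjective y
      obtain ⟨y', rfl⟩ := FreeObj.mk_surjective y'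
      exact FreeObj.sound (Rel.circ_add h i hr x y y'))
    (fun t x y => by
      obtain ⟨x, rfl⟩ := FreeObj.mk_surjective x
      obtain ⟨y, rfl⟩ := FreeObj.mk_surjective y
      exact FreeObj.sound (Rel.circ_smul h i hr t x y))

/-- The free operad `F(E)` on a collection `E`. -/
def free : Operad.{u, max u v} k where
  obj := FreeObj E
  act := freeAct E
  circ := freeCirc E
  assoc_nested := by
    intro a b c ab bc abc hab hbc h₁ h₂ p q r pq qr pqr hpq hqr h₃ h₄ i j f g h
    obtain ⟨f, rfl⟩ := FreeObj.mk_surjective f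
    obtain ⟨g, rfl⟩ := FreeObj.mk_surjective g
    obtain ⟨h, rfl⟩ := FreeObj.mk_surjective h
    exact FreeObj.sound (Rel.assoc_nested hab hbc h₁ h₂ hpq hqr h₃ h₄ i j f g h)
  assoc_parallel := by
    intro a b c ac bc abc hac hbc h₁ h₂ p q r pr qr pqr hpr hqr h₃ h₄ i j hij f g h
    obtain ⟨f, rfl⟩ := FreeObj.mk_surjective f
    obtain ⟨g, rfl⟩ := FreeObj.mk_surjective g
    obtain ⟨h, rfl⟩ := FreeObj.mk_surjective h
    exact FreeObj.sound (Rel.assoc_parallel hac hbc h₁ h₂ hpr hqr h₃ h₄ i j hij f g h)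
  circ_act := by
    intro a b c h i p q r hr σ τ f g
    obtain ⟨f, rfl⟩ := FreeObj.mk_surjective f
    obtain ⟨g, rfl⟩ := FreeObj.mk_surjective g
    exact FreeObj.sound (Rel.circ_act h i hr σ τ f g)

/-- The inclusion of the generators `E → F(E)`. -/
def gen (n : ℕ) (p : ℤ) : E.obj n p →ₗ[k] (free E).obj n p where
  toFun e := FreeObj.mk (Pre.of e)
  map_add' e e' := FreeObj.sound (Rel.of_add e e')
  map_smul' t e := FreeObj.sound (Rel.of_smul t e)

variable {E}

/-- Words in the free operad, with their weights: `W j` is the set of generators of weight `j`, the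
weight is additive under composition and invariant under permutations of the inputs. -/
inductive IsWord (W : ℕ → ∀ n p, Submodule k (E.obj n p)) :
    ℕ → ∀ {n : ℕ} {p : ℤ}, (free E).obj n p → Prop
  | gen {j n : ℕ} {p : ℤ} (e : E.obj n p) (he : e ∈ W j n p) : IsWord W j (gen E n p e)
  | act {j n : ℕ} {p : ℤ} (σ : Equiv.Perm (Fin (n + 1))) (x : (free E).obj n p) :
      IsWord W j x → IsWord W j ((free E).act n p σ x)
  | circ {j l a b c : ℕ} (h : a + b = c) (i : Fin (b + 1)) {p q r : ℤ} (hr : p + q = r)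
      (x : (free E).obj a p) (y : (free E).obj b q) :
      IsWord W j x → IsWord W l y → IsWord W (j + l) ((free E).circ h i hr x y)

/-- The span of the words of weight `j`. -/
def weightPart (W : ℕ → ∀ n p, Submodule k (E.obj n p)) (j n : ℕ) (p : ℤ) :
    Submodule k ((free E).obj n p) :=
  Submodule.span k {x | IsWord W j x}

variable (E) in
/-- The length grading `F^l(E)`: all generators have weight `1`. -/
def lengthPart (l n : ℕ) (p : ℤ) : Submodule k ((free E).obj n p) :=
  weightPart (fun j _ _ => if j = 1 then ⊤ else ⊥) l n p

/-- The TJ-grading `F(E)^j` for `E = E^0 ⊕ E^1 ⊕ ⋯`: the generators in `E^j` have weight `j`. -/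
def tjPart (Δ : E.Decomposition) (j n : ℕ) (p : ℤ) : Submodule k ((free E).obj n p) :=
  weightPart Δ.piece j n p

/-- The part `H^j(F(E), d)` of the homology: the classes of the cycles in `F(E)^j`. -/
def tjHomology (Δ : E.Decomposition) (d : (free E).Differential) (j n : ℕ) (p : ℤ) :
    Submodule k (d.homology.obj n p) :=
  ((tjPart Δ j n p).comap (d.cycles n p).subtype).map (d.cl n p)

end Free

/-- A TJ-model (bigraded model) `ρ : (F(Z), d) → (H, 0)` of an operad `H` with `H(1) = 0`. -/
structure TJModel {k : Type u} [Field k] (H : Operad.{u, v} k) where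
  /-- the generators -/
  Z : Collection.{u, w} k
  reduced : Z.Reduced
  /-- the decomposition `Z = Z^0 ⊕ Z^1 ⊕ ⋯` -/
  dec : Z.Decomposition
  /-- the differential of `F(Z)` -/
  d : (free Z).Differential
  /-- the map to `H` -/
  ρ : DGHom d H.zeroDifferential
  /-- `d` lowers the TJ-degree by one -/
  d_zero : ∀ n p q (h : q + 1 = p), ∀ z ∈ dec.piece 0 n p, d.d n p q h (gen Z n p z) = 0
  d_succ : ∀ j n p q (h : q + 1 = p), ∀ z ∈ dec.piece (j + 1) n p,
    d.d n p q h (gen Z n p z) ∈ tjPart dec j n q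
  /-- `d(Z) ⊆ F^{≥ 2}(Z)` -/
  minimal : ∀ n p q (h : q + 1 = p) (z : Z.obj n p),
    d.d n p q h (gen Z n p z) ∈ ⨆ l : ℕ, ⨆ _ : 2 ≤ l, lengthPart Z l n q
  /-- `ρ` vanishes on `Z^{≥ 1}` -/
  ρ_succ : ∀ j n p, ∀ z ∈ dec.piece (j + 1) n p, ρ.map n p (gen Z n p z) = 0
  /-- `H^0(ρ) : H^0(F(Z), d) → H(H, 0) = H` is an isomorphism -/
  bijective : ∀ n p, Function.Bijective
    ((ρ.homologyHom.map n p).domRestrict (tjHomology dec d 0 n p))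
  /-- `H^{≥ 1}(F(Z), d) = 0` -/
  acyclic : ∀ j n p, 1 ≤ j → tjHomology dec d j n p = ⊥

end OperadModels

open OperadModels

/-! The differential `D` and the map `α` are built together by induction on the weight (TJ-degree)
of the generators. On `Z^0` one takes `D = 0` and lets `α` choose cycles representing the classes
prescribed by `ρ`.

Suppose that `D` and `α` are good on weights at most `m`, and let `z` be a generator of weight `m +
1`. Then `c = dz` has weight `m`, is a `d`-cycle, and has `ρ c = 0`. One looks for a `D`-cycle equal
to `c` up to weights at most `m - 1`, whose image under `α` bounds. If `m = 0`, then `c` itself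
works, since `ρ c` is the class of `α c`. If `m ≥ 1`, then `D c` is a `D`-cycle of weights at most
`m - 2` whose image is the boundary of `α c`, so `D c = D y` with `y` of weights at most `m - 1`.
The class of the cycle `α (c - y)` equals `ρ x` for some `x` of weight `0`, and `c - y - x` is the
required element (`exists_extension_at`).

The engine is `IsFilteredModelUpTo.exists_d_eq`: a `D`-cycle of bounded weight whose image under `α`
bounds is itself a `D`-boundary. The top-weight part of such a cycle is a `d`-cycle, hence a
`d`-boundary by acyclicity, and subtracting the corresponding `D`-boundary lowers the weight. In
weight `0` the map `ρ` decides. The same lemma gives injectivity of `H(α)` at the end, and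
surjectivity already holds on weight `0` because `ρ` is onto there.

Characteristic zero enters twice: choices are made equivariant by averaging over the symmetric
groups (`exists_equivariant_section`), and the weight parts of the free operad are independent as
eigenspaces for the distinct scalars `2 ^ j` (`isInternal_tjPart`). -/

namespace OperadModels

/-! ### Gluing and averaging of equivariant linear maps -/

section Linear

variable {k : Type*} [Field k] {V W : Type*} [AddCommGroup V] [Module k V] [AddCommGroup W]
  [Module k W]

/-- Linear maps on the summands of a direct sum decomposition can be glued. -/
theorem exists_glue {A : ℕ → Submodule k V} (hA : DirectSum.IsInternal A) (f : ℕ → V →ₗ[k] W) :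
    ∃ g : V →ₗ[k] W, ∀ j, ∀ x ∈ A j, g x = f j x := by
  let e := LinearEquiv.ofBijective (DirectSum.coeLinearMap A) hA
  refine ⟨DirectSum.toModule k ℕ W (fun j => f j ∘ₗ (A j).subtype) ∘ₗ e.symm.toLinearMap, ?_⟩
  intro j x hx
  have : e.symm x = DirectSum.lof k ℕ (fun j => A j) j ⟨x, hx⟩ := by
    rw [LinearEquiv.symm_apply_eq]
    exact (DirectSum.coeLinearMap_lof A j ⟨x, hx⟩).symm
  simp [this]

theorem eq_of_eqOn_summands {A : ℕ → Submodule k V} (hA : ⨆ j, A j = ⊤) {f g : V →ₗ[k] W}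
    (h : ∀ j, ∀ x ∈ A j, f x = g x) : f = g := by
  have : (⊤ : Submodule k V) ≤ LinearMap.eqLocus f g := by
    rw [← hA]
    exact iSup_le fun j x hx => h j x hx
  ext x
  exact this (Submodule.mem_top (x := x))

/-- Equivariant linear maps on invariant summands can be glued to an equivariant map. -/
theorem exists_equivariant_glue {G : Type*} [Monoid G] (ρ : Representation k G V)
    (τ : Representation k G W) {A : ℕ → Submodule k V} (hA : DirectSum.IsInternal A)
    (hρ : ∀ j σ, ∀ x ∈ A j, ρ σ x ∈ A j) (f : ℕ → V →ₗ[k] W)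
    (hf : ∀ j σ x, f j (ρ σ x) = τ σ (f j x)) :
    ∃ g : V →ₗ[k] W, (∀ σ x, g (ρ σ x) = τ σ (g x)) ∧ ∀ j, ∀ x ∈ A j, g x = f j x := by
  obtain ⟨g, hg⟩ := exists_glue hA f
  refine ⟨g, fun σ x => ?_, hg⟩
  have : g ∘ₗ ρ σ = τ σ ∘ₗ g :=
    eq_of_eqOn_summands hA.submodule_iSup_eq_top fun j x hx => by
      simp [hg j _ (hρ j σ x hx), hg j x hx, hf]
  exact LinearMap.congr_fun this x

/-- An invariant linear relation between representations of a finite group which is total on an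
invariant subspace contains there the graph of an equivariant map. -/
theorem exists_equivariant_section [CharZero k] {G : Type*} [Group G] [Fintype G]
    (ρ : Representation k G V) (τ : Representation k G W) (A : Submodule k V)
    (hρ : ∀ σ, ∀ x ∈ A, ρ σ x ∈ A) (R : Submodule k (V × W))
    (hR : ∀ σ x y, (x, y) ∈ R → (ρ σ x, τ σ y) ∈ R) (hA : ∀ x ∈ A, ∃ y, (x, y) ∈ R) :
    ∃ f : V →ₗ[k] W, (∀ σ x, f (ρ σ x) = τ σ (f x)) ∧ ∀ x ∈ A, (x, f x) ∈ R := by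
  classical
  obtain ⟨f, hf⟩ : ∃ f : V →ₗ[k] W, ∀ x ∈ A, (x, f x) ∈ R := by
    -- Without equivariance: the part of `R` over `A` projects onto `A`, so it has a linear section,
    -- which is extended to `V` by a retraction of `V` onto `A`.
    let B : Submodule k R := A.comap (LinearMap.fst k V W ∘ₗ R.subtype)
    let φ : B →ₗ[k] A := (LinearMap.fst k V W ∘ₗ R.subtype).restrict fun x hx => hx
    have hφ : Function.Surjective φ := by
      rintro ⟨x, hx⟩
      obtain ⟨y, hy⟩ := hA x hx
      exact ⟨⟨⟨(x, y), hy⟩, hx⟩, rfl⟩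
    obtain ⟨s, hs⟩ := φ.exists_rightInverse_of_surjective (LinearMap.range_eq_top.2 hφ)
    obtain ⟨t, ht⟩ := A.subtype.exists_leftInverse_of_injective A.ker_subtype
    refine ⟨LinearMap.snd k V W ∘ₗ R.subtype ∘ₗ B.subtype ∘ₗ s ∘ₗ t, fun x hx => ?_⟩
    have h1 : t x = ⟨x, hx⟩ := LinearMap.congr_fun ht ⟨x, hx⟩
    have h2 : φ (s ⟨x, hx⟩) = ⟨x, hx⟩ := LinearMap.congr_fun hs ⟨x, hx⟩
    have h3 : (s ⟨x, hx⟩).1.1.1 = x := congrArg Subtype.val h2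
    have h4 := (s ⟨x, hx⟩).1.2
    simp only [LinearMap.comp_apply, h1, LinearMap.snd_apply, Submodule.subtype_apply]
    convert h4 using 1
    exact Prod.ext h3.symm rfl
  have hG : (Fintype.card G : k) ≠ 0 := by exact_mod_cast Fintype.card_ne_zero
  -- Average the conjugates of `f`. Each conjugate still has its graph over `A` inside the invariant
  -- relation, and so does the mean, since `R` is linear and the mean of copies of `x` is `x`.
  refine ⟨(Fintype.card G : k)⁻¹ • ∑ g : G, τ g ∘ₗ f ∘ₗ ρ g⁻¹, fun σ x => ?_, fun x hx => ?_⟩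
  · simp only [LinearMap.smul_apply, LinearMap.sum_apply, LinearMap.comp_apply, map_smul, map_sum]
    congr 1
    rw [← Equiv.sum_comp (Equiv.mulLeft σ)]
    refine Finset.sum_congr rfl fun g _ => ?_
    simp only [Equiv.coe_mulLeft, mul_inv_rev, map_mul, Module.End.mul_apply]
    rw [← Module.End.mul_apply (ρ σ⁻¹), ← map_mul]
    simp
  · have h : (Fintype.card G : k)⁻¹ • ∑ g : G, (x, (τ g ∘ₗ f ∘ₗ ρ g⁻¹) x) ∈ R := by
      refine R.smul_mem _ (R.sum_mem fun g _ => ?_)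
      have := hR g _ _ (hf _ (hρ g⁻¹ x hx))
      rw [← Module.End.mul_apply, ← map_mul] at this
      simpa using this
    convert h using 1
    ext
    · simp [Prod.fst_sum, ← Nat.cast_smul_eq_nsmul k, smul_smul, hG]
    · simp [Prod.snd_sum]

end Linear

/-! ### Homomorphisms and derivations out of the free operad -/

section Free

variable {k : Type u} [Field k] {E : Collection.{u, w} k}

/-- The value of a formal expression in an operad. -/
def Pre.lift (S : Operad.{u, v} k) (f : ∀ n p, E.obj n p →ₗ[k] S.obj n p) :
    ∀ {n : ℕ} {p : ℤ}, Pre E n p → S.obj n p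
  | _, _, .of e => f _ _ e
  | _, _, .zero => 0
  | _, _, .add x y => x.lift S f + y.lift S f
  | _, _, .smul t x => t • x.lift S f
  | n, p, .act σ x => S.act n p σ (x.lift S f)
  | _, _, .circ h i hr x y => S.circ h i hr (x.lift S f) (y.lift S f)

theorem Rel.lift_eq (S : Operad.{u, v} k) (f : ∀ n p, E.obj n p →ₗ[k] S.obj n p)
    (hf : ∀ n p σ x, f n p (E.act n p σ x) = S.act n p σ (f n p x)) {n : ℕ} {p : ℤ}
    {x y : Pre E n p} (h : Rel E x y) : x.lift S f = y.lift S f := by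
  induction h with
  | refl => rfl
  | symm _ ih => exact ih.symm
  | trans _ _ ih ih' => exact ih.trans ih'
  | assoc_nested => exact S.assoc_nested ..
  | assoc_parallel => exact S.assoc_parallel _ _ _ _ _ _ _ _ _ _ ‹_› _ _ _
  | circ_act => exact S.circ_act ..
  | add_assoc => exact _root_.add_assoc _ _ _
  | add_comm => exact _root_.add_comm _ _
  | add_smul => exact _root_.add_smul _ _ _
  | mul_smul => exact SemigroupAction.mul_smul _ _ _
  | _ => simp_all [Pre.lift]

/-- The homomorphism from the free operad extending an equivariant map on the generators. -/
def freeLift (S : Operad.{u, v} k) (f : ∀ n p, E.obj n p →ₗ[k] S.obj n p)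
    (hf : ∀ n p σ x, f n p (E.act n p σ x) = S.act n p σ (f n p x)) : (free E).Hom S where
  map n p :=
    { toFun := Quotient.lift (Pre.lift S f) fun _ _ h => Rel.lift_eq S f hf h
      map_add' := fun x y => by
        obtain ⟨x, rfl⟩ := FreeObj.mk_surjective x
        obtain ⟨y, rfl⟩ := FreeObj.mk_surjective y
        rfl
      map_smul' := fun t x => by
        obtain ⟨x, rfl⟩ := FreeObj.mk_surjective x
        rfl }
  map_act n p σ x := by
    obtain ⟨x, rfl⟩ := FreeObj.mk_surjective x
    rfl
  map_circ h i p q r hr x y := by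
    obtain ⟨x, rfl⟩ := FreeObj.mk_surjective x
    obtain ⟨y, rfl⟩ := FreeObj.mk_surjective y
    rfl

theorem freeLift_gen (S : Operad.{u, v} k) (f : ∀ n p, E.obj n p →ₗ[k] S.obj n p)
    (hf : ∀ n p σ x, f n p (E.act n p σ x) = S.act n p σ (f n p x)) (n : ℕ) (p : ℤ)
    (e : E.obj n p) : (freeLift S f hf).map n p (gen E n p e) = f n p e := rfl

/-- A derivation of degree `-1` of an operad. -/
structure Operad.Deriv (S : Operad.{u, v} k) where
  /-- the components -/
  d : ∀ n p, S.obj n p →ₗ[k] S.obj n (p - 1)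
  d_act : ∀ n p (σ : Equiv.Perm (Fin (n + 1))) (x : S.obj n p),
    d n p (S.act n p σ x) = S.act n (p - 1) σ (d n p x)
  d_circ : ∀ {a b c : ℕ} (h : a + b = c) (i : Fin (b + 1)) {p q r : ℤ} (hr : p + q = r)
    (f : S.obj a p) (g : S.obj b q),
    d c r (S.circ h i hr f g) = S.circ h i (by omega) (d a p f) g +
      sgn k p • S.circ h i (by omega) f (d b q g)

/-- The derivation underlying a differential. -/
def Operad.Differential.toDeriv {S : Operad.{u, v} k} (d : S.Differential) : S.Deriv where
  d n p := d.d n p (p - 1) (by omega)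
  d_act n p σ x := d.d_act ..
  d_circ h i p q r hr f g := d.d_circ ..

/-- The difference of two derivations. -/
def Operad.Deriv.sub {S : Operad.{u, v} k} (D D' : S.Deriv) : S.Deriv where
  d n p := D.d n p - D'.d n p
  d_act n p σ x := by simp [D.d_act, D'.d_act]
  d_circ h i p q r hr f g := by
    simp only [LinearMap.sub_apply, D.d_circ, D'.d_circ, map_sub, smul_sub]
    abel

theorem sgn_add (k : Type u) [Field k] (m n : ℤ) : sgn k (m + n) = sgn k m * sgn k n := by
  simp [sgn, Int.negOnePow_add]

theorem sgn_mul_self (k : Type u) [Field k] (n : ℤ) : sgn k n * sgn k n = 1 := by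
  rw [← sgn_add, sgn, Int.negOnePow_even _ (Even.add_self n)]
  simp

theorem sgn_sub_one (k : Type u) [Field k] (n : ℤ) : sgn k (n - 1) = -sgn k n := by
  simp [sgn, Int.negOnePow_sub]

/-- The value on a formal expression of the derivation extending `θ`, along the homomorphism
extending `f`. -/
def Pre.der (S : Operad.{u, v} k) (f : ∀ n p, E.obj n p →ₗ[k] S.obj n p)
    (θ : ∀ n p, E.obj n p →ₗ[k] S.obj n (p - 1)) :
    ∀ {n : ℕ} {p : ℤ}, Pre E n p → S.obj n (p - 1)
  | _, _, .of e => θ _ _ e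
  | _, _, .zero => 0
  | _, _, .add x y => x.der S f θ + y.der S f θ
  | _, _, .smul t x => t • x.der S f θ
  | n, p, .act σ x => S.act n (p - 1) σ (x.der S f θ)
  | _, _, .circ (p := p) h i hr x y =>
    S.circ h i (by omega) (x.der S f θ) (y.lift S f) +
      sgn k p • S.circ h i (by omega) (x.lift S f) (y.der S f θ)

/-- The Leibniz formula is compatible with every defining relation. The only substantial cases are
the two associativity axioms, where the Koszul signs of the three terms have to match. -/
theorem Rel.der_eq (S : Operad.{u, v} k) (f : ∀ n p, E.obj n p →ₗ[k] S.obj n p)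
    (hf : ∀ n p σ x, f n p (E.act n p σ x) = S.act n p σ (f n p x))
    (θ : ∀ n p, E.obj n p →ₗ[k] S.obj n (p - 1))
    (hθ : ∀ n p σ x, θ n p (E.act n p σ x) = S.act n (p - 1) σ (θ n p x)) {n : ℕ} {p : ℤ}
    {x y : Pre E n p} (h : Rel E x y) : x.der S f θ = y.der S f θ := by
  induction h with
  | refl => rfl
  | symm _ ih => exact ih.symm
  | trans _ _ ih ih' => exact ih.trans ih'
  | circ_congr h i hr hx hy ih ih' =>
    simp only [Pre.der]
    rw [ih, ih', hx.lift_eq S f hf, hy.lift_eq S f hf]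
  | assoc_nested hab hbc h₁ h₂ hpq hqr h₃ h₄ i j x y z =>
    rename_i p q r pq qr pqr
    simp only [Pre.der, Pre.lift, map_add, map_smul, _root_.smul_add, LinearMap.add_apply,
      LinearMap.smul_apply]
    rw [S.assoc_nested hab hbc h₁ h₂ (p := p - 1) (pq := pq - 1) (by omega) _ _ (by omega),
      S.assoc_nested hab hbc h₁ h₂ (q := q - 1) (pq := pq - 1) (by omega) (by omega) _ (by omega),
      S.assoc_nested hab hbc h₁ h₂ hpq, smul_smul, ← sgn_add, hpq, _root_.add_assoc]
  | assoc_parallel hac hbc h₁ h₂ hpr hqr h₃ h₄ i j hij x y z =>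
    rename_i p q r pr qr pqr
    simp only [Pre.der, Pre.lift, map_add, map_smul, _root_.smul_add]
    rw [S.assoc_parallel hac hbc h₁ h₂ (p := p - 1) (pr := pr - 1) (by omega) _ _
        (by omega) i j hij,
      S.assoc_parallel hac hbc h₁ h₂ (q := q - 1) (pr := pr) (by omega) (by omega) _
        (by omega) i j hij,
      S.assoc_parallel hac hbc h₁ h₂ (r := r - 1) (pr := pr - 1) (by omega) (by omega) _
        (by omega) i j hij]
    -- Differentiating the first factor changes the Koszul sign by `(-1)^q`, which is the sign for
    -- moving the derivation past the second factor. Adding `2 * q` to the exponent is harmless.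
    have h1 : sgn k ((p - 1) * q) = sgn k (p * q) * sgn k q := by
      rw [← sgn_add]
      have := sgn_add k ((p - 1) * q) (2 * q)
      have h2 : sgn k (2 * q) = 1 := by
        rw [two_mul, sgn_add, sgn_mul_self]
      rw [h2, mul_one] at this
      rw [← this]
      congr 1
      ring
    have h2 : sgn k p * sgn k (p * (q - 1)) = sgn k (p * q) := by
      rw [← sgn_add]
      congr 1
      ring
    rw [h1, smul_smul, h2]
    module
  | circ_act h i hr σ τ x y =>
    simp only [Pre.der, Pre.lift, map_add, map_smul, S.circ_act]
  | add_assoc => exact _root_.add_assoc _ _ _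
  | add_comm => exact _root_.add_comm _ _
  | add_smul => exact _root_.add_smul _ _ _
  | mul_smul => exact SemigroupAction.mul_smul _ _ _
  | _ =>
    simp_all only [Pre.der, Pre.lift, map_add, map_smul, LinearMap.add_apply, 
      LinearMap.smul_apply, _root_.zero_add, _root_.one_smul, _root_.zero_smul, _root_.smul_add,
      map_one, map_mul, Module.End.one_apply, Module.End.mul_apply]
    try module

/-- The derivation of the free operad extending an equivariant map on the generators. -/
def freeDeriv (θ : ∀ n p, E.obj n p →ₗ[k] (free E).obj n (p - 1))
    (hθ : ∀ n p σ x, θ n p (E.act n p σ x) = (free E).act n (p - 1) σ (θ n p x)) :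
    (free E).Deriv :=
  have hgen : ∀ n p σ x, gen E n p (E.act n p σ x) = (free E).act n p σ (gen E n p x) :=
    fun _ _ σ x => FreeObj.sound (Rel.of_act σ x)
  -- `Pre.der` evaluates the undifferentiated factors by `Pre.lift`; in the free operad itself these
  -- values are the classes of the factors, which yields the Leibniz rule.
  have hlift : ∀ {n : ℕ} {p : ℤ} (x : Pre E n p), x.lift (free E) (gen E) = FreeObj.mk x := by
    intro n p x
    induction x with
    | of => rfl
    | zero => rfl
    | add x y ih ih' => rw [Pre.lift, ih, ih']; rfl
    | smul t x ih => rw [Pre.lift, ih]; rfl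
    | act σ x ih => rw [Pre.lift, ih]; rfl
    | circ h i hr x y ih ih' => rw [Pre.lift, ih, ih']; rfl
  { d := fun n p =>
      { toFun := Quotient.lift (Pre.der (free E) (gen E) θ) fun _ _ h =>
          Rel.der_eq (free E) (gen E) hgen θ hθ h
        map_add' := fun x y => by
          obtain ⟨x, rfl⟩ := FreeObj.mk_surjective x
          obtain ⟨y, rfl⟩ := FreeObj.mk_surjective y
          rfl
        map_smul' := fun t x => by
          obtain ⟨x, rfl⟩ := FreeObj.mk_surjective x
          rfl }
    d_act := fun n p σ x => by
      obtain ⟨x, rfl⟩ := FreeObj.mk_surjective x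
      rfl
    d_circ := by
      intro a b c h i p q r hr x y
      obtain ⟨x, rfl⟩ := FreeObj.mk_surjective x
      obtain ⟨y, rfl⟩ := FreeObj.mk_surjective y
      refine Eq.trans (b := (free E).circ h i (by omega) (x.der (free E) (gen E) θ)
        (y.lift (free E) (gen E)) + sgn k p • (free E).circ h i (by omega)
          (x.lift (free E) (gen E)) (y.der (free E) (gen E) θ)) rfl ?_
      rw [hlift, hlift]
      rfl }

theorem freeDeriv_gen (θ : ∀ n p, E.obj n p →ₗ[k] (free E).obj n (p - 1))
    (hθ : ∀ n p σ x, θ n p (E.act n p σ x) = (free E).act n (p - 1) σ (θ n p x)) (n : ℕ) (p : ℤ)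
    (e : E.obj n p) : (freeDeriv θ hθ).d n p (gen E n p e) = θ n p e := rfl

end Free
-- The weight grading of the free operad
section Grading

variable {k : Type u} [Field k] {E : Collection.{u, w} k} {Δ : E.Decomposition}

theorem act_mem_tjPart {j n : ℕ} {p : ℤ} (σ : Equiv.Perm (Fin (n + 1)))
    {x : (free E).obj n p} (hx : x ∈ tjPart Δ j n p) :
    (free E).act n p σ x ∈ tjPart Δ j n p := by
  have : tjPart Δ j n p ≤ (tjPart Δ j n p).comap ((free E).act n p σ) :=
    Submodule.span_le.2 fun y hy => Submodule.subset_span (IsWord.act σ y hy)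
  exact this hx

theorem circ_mem_tjPart {j l a b c : ℕ} (h : a + b = c) (i : Fin (b + 1)) {p q r : ℤ}
    (hr : p + q = r) {x : (free E).obj a p} (hx : x ∈ tjPart Δ j a p) {y : (free E).obj b q}
    (hy : y ∈ tjPart Δ l b q) : (free E).circ h i hr x y ∈ tjPart Δ (j + l) c r := by
  have h1 : ∀ x', IsWord Δ.piece j x' →
      tjPart Δ l b q ≤ (tjPart Δ (j + l) c r).comap ((free E).circ h i hr x') := fun x' hx' =>
    Submodule.span_le.2 fun y' hy' => Submodule.subset_span (IsWord.circ h i hr x' y' hx' hy')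
  have h2 : tjPart Δ j a p ≤ (tjPart Δ (j + l) c r).comap (((free E).circ h i hr).flip y) :=
    Submodule.span_le.2 fun x' hx' => h1 x' hx' hy
  exact h2 hx

/-- Induction on words whose generators have weight at most `m`. -/
theorem tjPart_le {N : ℕ → ∀ n p, Submodule k ((free E).obj n p)} {m : ℕ}
    (gen_mem : ∀ j ≤ m, ∀ n p, ∀ z ∈ Δ.piece j n p, gen E n p z ∈ N j n p)
    (act_mem : ∀ j n p σ, ∀ x ∈ N j n p, (free E).act n p σ x ∈ N j n p)
    (circ_mem : ∀ j l {a b c : ℕ} (h : a + b = c) (i : Fin (b + 1)) {p q r : ℤ}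
      (hr : p + q = r), ∀ x ∈ N j a p, ∀ y ∈ N l b q, (free E).circ h i hr x y ∈ N (j + l) c r)
    {j : ℕ} (hj : j ≤ m) (n : ℕ) (p : ℤ) : tjPart Δ j n p ≤ N j n p := by
  refine Submodule.span_le.2 fun x hx => ?_
  induction hx with
  | gen e he => exact gen_mem _ hj _ _ _ he
  | act σ x _ ih => exact act_mem _ _ _ σ _ (ih hj)
  | circ h i hr x y _ _ ih ih' =>
    exact circ_mem _ _ h i hr _ (ih (by omega)) _ (ih' (by omega))

variable (Δ) in
/-- The sum of the parts of weights related to `j` by `R`. -/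
def relPart (R : ℕ → ℕ → Prop) (j n : ℕ) (p : ℤ) : Submodule k ((free E).obj n p) :=
  ⨆ l : ℕ, ⨆ _ : R l j, tjPart Δ l n p

theorem tjPart_le_relPart {R : ℕ → ℕ → Prop} {l j : ℕ} (h : R l j) (n : ℕ) (p : ℤ) :
    tjPart Δ l n p ≤ relPart Δ R j n p :=
  le_iSup₂_of_le (f := fun l (_ : R l j) => tjPart Δ l n p) l h le_rfl

theorem relPart_mono {R R' : ℕ → ℕ → Prop} {j j' : ℕ} (h : ∀ l, R l j → R' l j') (n : ℕ)
    (p : ℤ) : relPart Δ R j n p ≤ relPart Δ R' j' n p :=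
  iSup₂_le fun l hl => tjPart_le_relPart (h l hl) n p

theorem act_mem_relPart {R : ℕ → ℕ → Prop} {j n : ℕ} {p : ℤ} (σ : Equiv.Perm (Fin (n + 1)))
    {x : (free E).obj n p} (hx : x ∈ relPart Δ R j n p) :
    (free E).act n p σ x ∈ relPart Δ R j n p := by
  have : relPart Δ R j n p ≤ (relPart Δ R j n p).comap ((free E).act n p σ) :=
    iSup₂_le fun l hl y hy => tjPart_le_relPart hl n p (act_mem_tjPart σ hy)
  exact this hx

theorem circ_mem_relPart_left {R : ℕ → ℕ → Prop} (hR : ∀ l j s, R l j → R (l + s) (j + s))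
    {j l a b c : ℕ} (h : a + b = c) (i : Fin (b + 1)) {p q r : ℤ}
    (hr : p + q = r) {x : (free E).obj a p} (hx : x ∈ relPart Δ R j a p) {y : (free E).obj b q}
    (hy : y ∈ tjPart Δ l b q) : (free E).circ h i hr x y ∈ relPart Δ R (j + l) c r := by
  have : relPart Δ R j a p ≤ (relPart Δ R (j + l) c r).comap (((free E).circ h i hr).flip y) :=
    iSup₂_le fun s hs x' hx' =>
      tjPart_le_relPart (hR s j l hs) c r (circ_mem_tjPart h i hr hx' hy)
  exact this hx

theorem circ_mem_relPart_right {R : ℕ → ℕ → Prop} (hR : ∀ l j s, R l j → R (l + s) (j + s))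
    {j l a b c : ℕ} (h : a + b = c) (i : Fin (b + 1)) {p q r : ℤ}
    (hr : p + q = r) {x : (free E).obj a p} (hx : x ∈ tjPart Δ j a p) {y : (free E).obj b q}
    (hy : y ∈ relPart Δ R l b q) : (free E).circ h i hr x y ∈ relPart Δ R (j + l) c r := by
  have : relPart Δ R l b q ≤ (relPart Δ R (j + l) c r).comap ((free E).circ h i hr x) :=
    iSup₂_le fun s hs y' hy' => by
      have hs' : R (j + s) (j + l) := by
        rw [Nat.add_comm j, Nat.add_comm j]
        exact hR s l j hs
      exact tjPart_le_relPart hs' c r (circ_mem_tjPart h i hr hx hy')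
  exact this hy

/-- A derivation shifts the weights as it does on the generators. -/
theorem Operad.Deriv.mem_relPart (D : (free E).Deriv) {R : ℕ → ℕ → Prop}
    (hR : ∀ l j s, R l j → R (l + s) (j + s)) {m : ℕ}
    (hD : ∀ j ≤ m, ∀ n p, ∀ z ∈ Δ.piece j n p,
      D.d n p (gen E n p z) ∈ relPart Δ R j n (p - 1))
    {j : ℕ} (hj : j ≤ m) {n : ℕ} {p : ℤ} {x : (free E).obj n p} (hx : x ∈ tjPart Δ j n p) :
    D.d n p x ∈ relPart Δ R j n (p - 1) := by
  -- The induction also carries membership in `tjPart`, because each Leibniz term needs the weight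
  -- of the factor that is not differentiated.
  have := tjPart_le (Δ := Δ)
    (N := fun j n p => tjPart Δ j n p ⊓ (relPart Δ R j n (p - 1)).comap (D.d n p)) (m := m)
    (fun j hj n p z hz => ⟨Submodule.subset_span (IsWord.gen z hz), hD j hj n p z hz⟩)
    (fun j n p σ x hx => ⟨act_mem_tjPart σ hx.1, by
      rw [SetLike.mem_coe, Submodule.mem_comap, D.d_act]
      exact act_mem_relPart σ hx.2⟩)
    (fun j l a b c h i p q r hr x hx y hy => ⟨circ_mem_tjPart h i hr hx.1 hy.1, by
      rw [SetLike.mem_coe, Submodule.mem_comap, D.d_circ]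
      exact add_mem (circ_mem_relPart_left hR h i _ hx.2 hy.1)
        (Submodule.smul_mem _ _ (circ_mem_relPart_right hR h i _ hx.1 hy.2))⟩) hj n p hx
  exact this.2

/-- Derivations which agree on generators of weight at most `m` agree on words of such weights. -/
theorem Operad.Deriv.eqOn_tjPart (D D' : (free E).Deriv) {m : ℕ}
    (h : ∀ j ≤ m, ∀ n p, ∀ z ∈ Δ.piece j n p, D.d n p (gen E n p z) = D'.d n p (gen E n p z))
    {j : ℕ} (hj : j ≤ m) {n : ℕ} {p : ℤ} {x : (free E).obj n p} (hx : x ∈ tjPart Δ j n p) :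
    D.d n p x = D'.d n p x := by
  -- With the empty relation `relPart` is zero, so the weight estimate says that `D - D'` vanishes.
  have := (D.sub D').mem_relPart (Δ := Δ) (R := fun _ _ => False) (by simp) (m := m)
    (fun j hj n p z hz => by simp [Operad.Deriv.sub, h j hj n p z hz]) hj hx
  simpa [relPart, Operad.Deriv.sub, sub_eq_zero] using this

/-- Homomorphisms which agree on generators of weight at most `m` agree on words of such
weights. -/
theorem Operad.Hom.eqOn_tjPart {S : Operad.{u, v} k} (φ ψ : (free E).Hom S) {m : ℕ}
    (h : ∀ j ≤ m, ∀ n p, ∀ z ∈ Δ.piece j n p, φ.map n p (gen E n p z) = ψ.map n p (gen E n p z))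
    {j : ℕ} (hj : j ≤ m) {n : ℕ} {p : ℤ} {x : (free E).obj n p} (hx : x ∈ tjPart Δ j n p) :
    φ.map n p x = ψ.map n p x :=
  tjPart_le (Δ := Δ) (N := fun _ n p => LinearMap.eqLocus (φ.map n p) (ψ.map n p)) (m := m)
    (fun j hj n p z hz => h j hj n p z hz)
    (fun j n p σ x hx => by
      rw [LinearMap.mem_eqLocus] at hx ⊢
      rw [φ.map_act, ψ.map_act, hx])
    (fun j l a b c h i p q r hr x hx y hy => by
      rw [LinearMap.mem_eqLocus] at hx hy ⊢
      rw [φ.map_circ, ψ.map_circ, hx, hy]) hj n p hx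

variable (Δ)

/-- The generators are sums of homogeneous ones, and the sum of the weight parts is closed under all
operations because weights add under composition. -/
theorem iSup_tjPart (n : ℕ) (p : ℤ) : ⨆ j, tjPart Δ j n p = ⊤ := by
  refine eq_top_iff.2 fun x _ => ?_
  obtain ⟨x, rfl⟩ := FreeObj.mk_surjective x
  induction x with
  | of e =>
    rename_i n p _
    have : (⊤ : Submodule k (E.obj n p)) ≤ (⨆ j, tjPart Δ j n p).comap (gen E n p) := by
      rw [← (Δ.isInternal n p).submodule_iSup_eq_top]
      exact iSup_le fun j z hz =>
        Submodule.mem_iSup_of_mem j (Submodule.subset_span (IsWord.gen z hz))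
    exact this (Submodule.mem_top (x := e))
  | zero => exact zero_mem _
  | add x y ih ih' => exact add_mem (ih trivial) (ih' trivial)
  | smul t x ih => exact Submodule.smul_mem _ t (ih trivial)
  | act σ x ih =>
    rename_i n p _
    have : (⨆ j, tjPart Δ j n p) ≤ (⨆ j, tjPart Δ j n p).comap ((free E).act n p σ) :=
      iSup_le fun j y hy => Submodule.mem_iSup_of_mem j (act_mem_tjPart σ hy)
    exact this (ih trivial)
  | circ h i hr x y ih ih' =>
    rename_i a b c p q r _
    have h1 : ∀ (j : ℕ) (x' : (free E).obj a p), x' ∈ tjPart Δ j a p →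
        (⨆ j, tjPart Δ j b q) ≤ (⨆ j, tjPart Δ j c r).comap ((free E).circ h i hr x') :=
      fun j x' hx' => iSup_le fun l y' hy' =>
        Submodule.mem_iSup_of_mem (j + l) (circ_mem_tjPart h i hr hx' hy')
    have h2 : (⨆ j, tjPart Δ j a p) ≤
        (⨆ j, tjPart Δ j c r).comap (((free E).circ h i hr).flip (FreeObj.mk y)) :=
      iSup_le fun j x' hx' => h1 j x' hx' (ih' trivial)
    exact h2 (ih trivial)

theorem gen_act (n : ℕ) (p : ℤ) (σ : Equiv.Perm (Fin (n + 1))) (e : E.obj n p) :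
    gen E n p (E.act n p σ e) = (free E).act n p σ (gen E n p e) :=
  FreeObj.sound (Rel.of_act σ e)

/-- The weight parts are eigenspaces of the endomorphism of the free operad which multiplies the
generators of weight `j` by `2 ^ j`. -/
theorem isInternal_tjPart [CharZero k] (n : ℕ) (p : ℤ) :
    DirectSum.IsInternal fun j => tjPart Δ j n p := by
  rw [DirectSum.isInternal_submodule_iff_iSupIndep_and_iSup_eq_top]
  refine ⟨?_, iSup_tjPart Δ n p⟩
  choose f hf hf' using fun n p => exists_equivariant_glue (E.act n p) ((free E).act n p)
    (Δ.isInternal n p) (fun j σ x hx => Δ.act_mem j n p σ x hx)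
    (fun j => (2 : k) ^ j • gen E n p) (fun j σ x => by simp [gen_act])
  let ψ := freeLift (free E) f hf
  have hψ : ∀ j, tjPart Δ j n p ≤ Module.End.eigenspace (ψ.map n p) (2 ^ j) := fun j =>
    tjPart_le (Δ := Δ)
      (N := fun j n p => Module.End.eigenspace (ψ.map n p : Module.End k ((free E).obj n p))
        (2 ^ j)) (m := j)
      (fun j _ n p z hz => by
        rw [Module.End.mem_eigenspace_iff, freeLift_gen, hf' n p j z hz]
        rfl)
      (fun j n p σ x hx => by
        rw [Module.End.mem_eigenspace_iff] at hx ⊢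
        rw [ψ.map_act, hx, map_smul])
      (fun j l a b c h i p q r hr x hx y hy => by
        rw [Module.End.mem_eigenspace_iff] at hx hy ⊢
        rw [ψ.map_circ, hx, hy, map_smul, map_smul, LinearMap.smul_apply, smul_smul, pow_add,
          mul_comm]) le_rfl n p
  -- In characteristic zero the scalars `2 ^ j` are distinct, so the eigenspaces containing the
  -- weight parts are independent.
  have hinj : Function.Injective fun j : ℕ => (2 : k) ^ j := by
    intro i j hij
    have : (2 : ℕ) ^ i = 2 ^ j := by
      dsimp only at hij
      exact_mod_cast hij
    exact Nat.pow_right_injective le_rfl this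
  exact ((Module.End.eigenspaces_iSupIndep (ψ.map n p)).comp hinj).mono hψ

/-- The projections of the free operad to its weight parts. -/
theorem exists_proj [CharZero k] (m n : ℕ) (p : ℤ) :
    ∃ π : (free E).obj n p →ₗ[k] (free E).obj n p, (∀ x, π x ∈ tjPart Δ m n p) ∧
      (∀ x ∈ tjPart Δ m n p, π x = x) ∧ ∀ j, j ≠ m → ∀ x ∈ tjPart Δ j n p, π x = 0 := by
  obtain ⟨π, hπ⟩ := exists_glue (isInternal_tjPart Δ n p)
    (fun j => if j = m then LinearMap.id else 0)
  refine ⟨π, fun x => ?_, fun x hx => ?_, fun j hj x hx => ?_⟩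
  · have : (⊤ : Submodule k ((free E).obj n p)) ≤ (tjPart Δ m n p).comap π := by
      rw [← iSup_tjPart Δ n p]
      refine iSup_le fun j x hx => ?_
      rw [Submodule.mem_comap, hπ j x hx]
      split_ifs with h
      · subst h
        exact hx
      · exact zero_mem _
    exact this (Submodule.mem_top (x := x))
  · simp [hπ m x hx]
  · simp [hπ j x hx, hj]

end Grading
-- Cycles and their homology classes as a linear relation
section Boundaries

variable {k : Type u} [Field k] {S : Operad.{u, v} k} (d : S.Differential)

theorem Operad.Differential.mem_boundaries_iff {n : ℕ} {p q : ℤ} (h : q + 1 = p)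
    {x : d.cycles n q} : x ∈ d.boundaries n q ↔ ∃ y : S.obj n p, d.d n p q h y = x.1 := by
  subst h
  exact Iff.rfl

theorem Operad.Differential.cl_eq_zero_iff {n : ℕ} {p q : ℤ} (h : q + 1 = p)
    {x : d.cycles n q} : d.cl n q x = 0 ↔ ∃ y : S.obj n p, d.d n p q h y = x.1 :=
  (Submodule.Quotient.mk_eq_zero _).trans (d.mem_boundaries_iff h)

/-- The pairs consisting of a cycle and its homology class. -/
def Operad.Differential.clGraph (n : ℕ) (p : ℤ) :
    Submodule k (S.obj n p × d.homology.obj n p) :=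
  LinearMap.range ((d.cycles n p).subtype.prod (d.cl n p))

theorem Operad.Differential.mem_clGraph {n : ℕ} {p : ℤ} {s : S.obj n p}
    {c : d.homology.obj n p} :
    (s, c) ∈ d.clGraph n p ↔ ∃ h : s ∈ d.cycles n p, d.cl n p ⟨s, h⟩ = c := by
  constructor
  · rintro ⟨x, hx⟩
    obtain ⟨rfl, rfl⟩ := Prod.mk.inj hx
    exact ⟨x.2, rfl⟩
  · rintro ⟨h, rfl⟩
    exact ⟨⟨s, h⟩, rfl⟩

/-- Homology classes are compared by subtracting pairs in `clGraph`; a pair with second entry zero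
is then read off as a boundary. -/
theorem Operad.Differential.mem_clGraph_zero {n : ℕ} {p q : ℤ} (h : q + 1 = p) {s : S.obj n q} :
    (s, 0) ∈ d.clGraph n q ↔ ∃ y : S.obj n p, d.d n p q h y = s := by
  rw [d.mem_clGraph]
  constructor
  · rintro ⟨hs, h0⟩
    exact (d.cl_eq_zero_iff h).1 h0
  · rintro ⟨y, rfl⟩
    exact ⟨d.mem_cycles.2 fun _ _ => d.d_d .., (d.cl_eq_zero_iff h).2 ⟨y, rfl⟩⟩

theorem Operad.Differential.act_mem_clGraph {n : ℕ} {p : ℤ} (σ : Equiv.Perm (Fin (n + 1)))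
    {s : S.obj n p} {c : d.homology.obj n p} (h : (s, c) ∈ d.clGraph n p) :
    (S.act n p σ s, d.homology.act n p σ c) ∈ d.clGraph n p := by
  obtain ⟨hs, rfl⟩ := d.mem_clGraph.1 h
  exact d.mem_clGraph.2 ⟨d.act_mem_cycles σ _ hs, rfl⟩

theorem Operad.Differential.circ_mem_clGraph {a b c : ℕ} (h : a + b = c) (i : Fin (b + 1))
    {p q r : ℤ} (hr : p + q = r) {s : S.obj a p} {x : d.homology.obj a p}
    (hs : (s, x) ∈ d.clGraph a p) {t : S.obj b q} {y : d.homology.obj b q}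
    (ht : (t, y) ∈ d.clGraph b q) :
    (S.circ h i hr s t, d.homology.circ h i hr x y) ∈ d.clGraph c r := by
  obtain ⟨hs', rfl⟩ := d.mem_clGraph.1 hs
  obtain ⟨ht', rfl⟩ := d.mem_clGraph.1 ht
  exact d.mem_clGraph.2 ⟨d.circ_mem_cycles h i hr hs' ht', rfl⟩

theorem Operad.Differential.eq_zero_of_mem_clGraph {n : ℕ} {p : ℤ} {c : d.homology.obj n p}
    (h : (0, c) ∈ d.clGraph n p) : c = 0 := by
  obtain ⟨h0, rfl⟩ := d.mem_clGraph.1 h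
  exact map_zero (d.cl n p)

end Boundaries

/-! ### Exactness of the bigraded model, weight by weight -/

namespace TJModel

variable {k : Type u} [Field k] {H : Operad.{u, v} k} (M : TJModel.{u, v, w} H)

theorem d_mem {j n : ℕ} {p : ℤ} {x : (free M.Z).obj n p} (hx : x ∈ tjPart M.dec j n p) :
    M.d.toDeriv.d n p x ∈ relPart M.dec (fun l j => l + 1 = j) j n (p - 1) := by
  refine M.d.toDeriv.mem_relPart (fun l j s h => by omega) (m := j) ?_ le_rfl hx
  intro j _ n p z hz
  cases j with
  | zero =>
    have : M.d.toDeriv.d n p (gen M.Z n p z) = 0 := M.d_zero n p _ _ z hz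
    rw [this]
    exact zero_mem _
  | succ j => exact tjPart_le_relPart (R := fun l j => l + 1 = j) rfl _ _ (M.d_succ j n p _ _ z hz)

theorem d_mem_tjPart {j n : ℕ} {p : ℤ} {x : (free M.Z).obj n p}
    (hx : x ∈ tjPart M.dec (j + 1) n p) : M.d.toDeriv.d n p x ∈ tjPart M.dec j n (p - 1) := by
  refine (iSup₂_le fun l hl => ?_ : relPart M.dec (fun l j => l + 1 = j) (j + 1) n (p - 1) ≤ _)
    (M.d_mem hx)
  obtain rfl : l = j := by omega
  exact le_rfl

theorem d_eq_zero {n : ℕ} {p : ℤ} {x : (free M.Z).obj n p} (hx : x ∈ tjPart M.dec 0 n p) :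
    M.d.toDeriv.d n p x = 0 := by
  simpa [relPart] using M.d_mem hx

/-- Since `d` is homogeneous of weight `-1`, it intertwines the projections to weights `m + 1` and
`m`; hence a primitive may be replaced by its component of weight `m + 1`. -/
theorem exists_tjPart_of_exists [CharZero k] {m n : ℕ} {p : ℤ} {u : (free M.Z).obj n (p - 1)}
    (hu : u ∈ tjPart M.dec m n (p - 1)) (h : ∃ y, M.d.toDeriv.d n p y = u) :
    ∃ v ∈ tjPart M.dec (m + 1) n p, M.d.toDeriv.d n p v = u := by
  obtain ⟨y, rfl⟩ := h
  obtain ⟨π, hπ, hπ', hπ''⟩ := exists_proj M.dec (m + 1) n p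
  obtain ⟨τ, hτ, hτ', hτ''⟩ := exists_proj M.dec m n (p - 1)
  refine ⟨π y, hπ y, ?_⟩
  have : M.d.toDeriv.d n p ∘ₗ π = τ ∘ₗ M.d.toDeriv.d n p := by
    refine eq_of_eqOn_summands (iSup_tjPart M.dec n p) fun j x hx => ?_
    simp only [LinearMap.comp_apply]
    cases j with
    | zero => rw [hπ'' 0 (by omega) x hx, M.d_eq_zero hx, map_zero, map_zero]
    | succ j =>
      by_cases hj : j = m
      · subst hj
        rw [hπ' x hx, hτ' _ (M.d_mem_tjPart hx)]
      · rw [hπ'' _ (by omega) x hx, hτ'' j hj _ (M.d_mem_tjPart hx), map_zero]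
  rw [← hτ' _ hu]
  exact LinearMap.congr_fun this y

theorem exact_succ [CharZero k] {m n : ℕ} {p : ℤ} {u : (free M.Z).obj n (p - 1)}
    (hu : u ∈ tjPart M.dec (m + 1) n (p - 1)) (hd : M.d.toDeriv.d n (p - 1) u = 0) :
    ∃ v ∈ tjPart M.dec (m + 2) n p, M.d.toDeriv.d n p v = u := by
  refine M.exists_tjPart_of_exists hu ?_
  have h : M.d.cl n (p - 1) ⟨u, hd⟩ ∈ tjHomology M.dec M.d (m + 1) n (p - 1) :=
    ⟨⟨u, hd⟩, hu, rfl⟩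
  rw [M.acyclic (m + 1) n (p - 1) (by omega)] at h
  exact (M.d.cl_eq_zero_iff (p := p) (by omega)).1 h

theorem exact_zero [CharZero k] {n : ℕ} {p : ℤ} {u : (free M.Z).obj n (p - 1)}
    (hu : u ∈ tjPart M.dec 0 n (p - 1)) (hρ : M.ρ.map n (p - 1) u = 0) :
    ∃ v ∈ tjPart M.dec 1 n p, M.d.toDeriv.d n p v = u := by
  refine M.exists_tjPart_of_exists hu ?_
  have hd := M.d_eq_zero hu
  have h : M.d.cl n (p - 1) ⟨u, hd⟩ ∈ tjHomology M.dec M.d 0 n (p - 1) := ⟨⟨u, hd⟩, hu, rfl⟩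
  -- Injectivity of `ρ` on the weight-zero part of the homology.
  have h0 : (⟨_, h⟩ : tjHomology M.dec M.d 0 n (p - 1)) = 0 := by
    apply (M.bijective n (p - 1)).1
    rw [map_zero]
    show H.zeroDifferential.cl n (p - 1) (M.ρ.cyclesMap n (p - 1) ⟨u, hd⟩) = 0
    have : M.ρ.cyclesMap n (p - 1) ⟨u, hd⟩ = 0 := Subtype.ext hρ
    rw [this, map_zero]
  exact (M.d.cl_eq_zero_iff (p := p) (by omega)).1 (congrArg Subtype.val h0)

theorem exists_ρ_eq {n : ℕ} {p : ℤ} (c : H.obj n p) :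
    ∃ x ∈ tjPart M.dec 0 n p, M.ρ.map n p x = c := by
  obtain ⟨⟨y, hy⟩, h⟩ := (M.bijective n p).2
    (H.zeroDifferential.cl n p ⟨c, (H.zeroDifferential.mem_cycles).2 fun _ _ => rfl⟩)
  obtain ⟨x, hx, rfl⟩ := hy
  refine ⟨x.1, hx, ?_⟩
  -- For the zero differential only `0` is a boundary, so equality of classes is equality of
  -- elements.
  have h' : H.zeroDifferential.cl n p (M.ρ.cyclesMap n p x -
      ⟨c, (H.zeroDifferential.mem_cycles).2 fun _ _ => rfl⟩) = 0 := by
    rw [map_sub, sub_eq_zero]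
    exact h
  obtain ⟨z, hz⟩ := (H.zeroDifferential.cl_eq_zero_iff rfl).1 h'
  exact (sub_eq_zero.1 (hz.symm : M.ρ.map n p x.1 - c = 0))

theorem ρ_d (n : ℕ) (p : ℤ) (x : (free M.Z).obj n p) :
    M.ρ.map n (p - 1) (M.d.toDeriv.d n p x) = 0 :=
  M.ρ.map_d n p (p - 1) (by omega) x

end TJModel

/-! ### Partial filtered models and their exactness -/

section Stage

variable {k : Type u} [Field k] {S : Operad.{u, v} k} {dS : S.Differential}
  {M : TJModel.{u, v, w} dS.homology}

variable (M) in
/-- The derivation `D` and the homomorphism `α` satisfy the conditions on a filtered model on the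
generators of weight at most `m`. -/
structure IsFilteredModelUpTo (D : (free M.Z).Deriv) (α : (free M.Z).Hom S) (m : ℕ) : Prop where
  lower : ∀ j ≤ m, ∀ n p, ∀ z ∈ M.dec.piece j n p,
    D.d n p (gen M.Z n p z) - M.d.toDeriv.d n p (gen M.Z n p z) ∈
      relPart M.dec (fun l j => l + 2 ≤ j) j n (p - 1)
  d_d : ∀ j ≤ m, ∀ n p, ∀ z ∈ M.dec.piece j n p,
    D.d n (p - 1) (D.d n p (gen M.Z n p z)) = 0
  map_d : ∀ j ≤ m, ∀ n p, ∀ z ∈ M.dec.piece j n p,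
    α.map n (p - 1) (D.d n p (gen M.Z n p z)) =
      dS.toDeriv.d n p (α.map n p (gen M.Z n p z))
  cl_eq : ∀ n p, ∀ z ∈ M.dec.piece 0 n p,
    (α.map n p (gen M.Z n p z), M.ρ.map n p (gen M.Z n p z)) ∈ dS.clGraph n p

namespace IsFilteredModelUpTo

variable {D : (free M.Z).Deriv} {α : (free M.Z).Hom S} {m : ℕ}

/-- The difference `D - d` is again a derivation, so the estimate passes from generators to words.
-/
theorem d_sub_d_mem (h : IsFilteredModelUpTo M D α m) {j : ℕ} (hj : j ≤ m) {n : ℕ} {p : ℤ}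
    {x : (free M.Z).obj n p} (hx : x ∈ tjPart M.dec j n p) :
    D.d n p x - M.d.toDeriv.d n p x ∈ relPart M.dec (fun l j => l + 2 ≤ j) j n (p - 1) :=
  (D.sub M.d.toDeriv).mem_relPart (fun l j s h => by omega) h.lower hj hx

theorem d_mem (h : IsFilteredModelUpTo M D α m) {j : ℕ} (hj : j ≤ m) {n : ℕ} {p : ℤ}
    {x : (free M.Z).obj n p} (hx : x ∈ tjPart M.dec j n p) :
    D.d n p x ∈ relPart M.dec (fun l j => l + 1 ≤ j) j n (p - 1) := by
  rw [← sub_add_cancel (D.d n p x) (M.d.toDeriv.d n p x)]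
  exact add_mem (relPart_mono (fun l hl => by omega) _ _ (h.d_sub_d_mem hj hx))
    (relPart_mono (fun l hl => by omega) _ _ (M.d_mem hx))

theorem d_mem_of_le (h : IsFilteredModelUpTo M D α m) {j : ℕ} (hj : j ≤ m) {n : ℕ} {p : ℤ}
    {x : (free M.Z).obj n p} (hx : x ∈ relPart M.dec (· ≤ ·) j n p) :
    D.d n p x ∈ relPart M.dec (fun l j => l + 1 ≤ j) j n (p - 1) := by
  have : relPart M.dec (· ≤ ·) j n p ≤
      (relPart M.dec (fun l j => l + 1 ≤ j) j n (p - 1)).comap (D.d n p) :=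
    iSup₂_le fun l hl y hy =>
      relPart_mono (fun s hs => by omega) _ _ (h.d_mem (hl.trans hj) hy)
  exact this hx

/-- There is no weight `l` with `l + 2 ≤ j` when `j < 2`, so nothing can be added to `d`. -/
theorem eq_of_lt_two (h : IsFilteredModelUpTo M D α m) {j : ℕ} (hj : j ≤ m) (hj' : j < 2)
    {n : ℕ} {p : ℤ} {x : (free M.Z).obj n p} (hx : x ∈ tjPart M.dec j n p) :
    D.d n p x = M.d.toDeriv.d n p x := by
  have h1 := h.d_sub_d_mem hj hx
  have h2 : relPart M.dec (fun l j => l + 2 ≤ j) j n (p - 1) ≤ ⊥ :=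
    iSup₂_le fun l hl => by omega
  exact sub_eq_zero.1 ((Submodule.mem_bot k).1 (h2 h1))

/-- The square of an odd derivation is a derivation: the mixed terms carry the signs of `p - 1` and
`p` and cancel. So it suffices that it vanishes on generators. -/
theorem d_d_eq_zero (h : IsFilteredModelUpTo M D α m) {n : ℕ} {p : ℤ}
    {x : (free M.Z).obj n p} (hx : x ∈ relPart M.dec (· ≤ ·) m n p) :
    D.d n (p - 1) (D.d n p x) = 0 := by
  have : relPart M.dec (· ≤ ·) m n p ≤ LinearMap.ker (D.d n (p - 1) ∘ₗ D.d n p) :=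
    iSup₂_le fun l hl => tjPart_le (m := m)
      (N := fun _ n p => LinearMap.ker (D.d n (p - 1) ∘ₗ D.d n p))
      (fun j hj n p z hz => h.d_d j hj n p z hz)
      (fun j n p σ x hx => by
        simp only [LinearMap.mem_ker, LinearMap.comp_apply] at hx ⊢
        rw [D.d_act, D.d_act, hx, map_zero])
      (fun j l a b c h i p q r hr x hx y hy => by
        simp only [LinearMap.mem_ker, LinearMap.comp_apply] at hx hy ⊢
        rw [D.d_circ, map_add, map_smul, D.d_circ, D.d_circ, hx, hy, sgn_sub_one]
        simp) hl n p
  exact this hx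

theorem map_d_eq (h : IsFilteredModelUpTo M D α m) {n : ℕ} {p : ℤ}
    {x : (free M.Z).obj n p} (hx : x ∈ relPart M.dec (· ≤ ·) m n p) :
    α.map n (p - 1) (D.d n p x) = dS.toDeriv.d n p (α.map n p x) := by
  have : relPart M.dec (· ≤ ·) m n p ≤
      LinearMap.eqLocus (α.map n (p - 1) ∘ₗ D.d n p) (dS.toDeriv.d n p ∘ₗ α.map n p) :=
    iSup₂_le fun l hl => tjPart_le (m := m)
      (N := fun _ n p =>
        LinearMap.eqLocus (α.map n (p - 1) ∘ₗ D.d n p) (dS.toDeriv.d n p ∘ₗ α.map n p))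
      (fun j hj n p z hz => h.map_d j hj n p z hz)
      (fun j n p σ x hx => by
        simp only [LinearMap.mem_eqLocus, LinearMap.comp_apply] at hx ⊢
        rw [D.d_act, α.map_act, α.map_act, dS.toDeriv.d_act, hx])
      (fun j l a b c h i p q r hr x hx y hy => by
        simp only [LinearMap.mem_eqLocus, LinearMap.comp_apply] at hx hy ⊢
        rw [D.d_circ, map_add, map_smul, α.map_circ, α.map_circ, α.map_circ, dS.toDeriv.d_circ,
          hx, hy]) hl n p
  exact this hx

theorem mem_clGraph (h : IsFilteredModelUpTo M D α m) {n : ℕ} {p : ℤ}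
    {x : (free M.Z).obj n p} (hx : x ∈ tjPart M.dec 0 n p) :
    (α.map n p x, M.ρ.map n p x) ∈ dS.clGraph n p := by
  refine tjPart_le (m := 0)
    (N := fun _ n p => (dS.clGraph n p).comap ((α.map n p).prod (M.ρ.map n p)))
    (fun j hj n p z hz => ?_) ?_ ?_ le_rfl n p hx
  · obtain rfl : j = 0 := by omega
    exact h.cl_eq n p z hz
  · intro j n p σ x hx
    show (_, _) ∈ dS.clGraph n p
    rw [α.map_act, M.ρ.map_act]
    exact dS.act_mem_clGraph σ hx
  · intro j l a b c e i p q r hr x hx y hy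
    show (_, _) ∈ dS.clGraph c r
    rw [α.map_circ, M.ρ.map_circ]
    exact dS.circ_mem_clGraph e i hr hx hy

/-- A `D`-cycle of weights at most `i` whose image bounds is a `D`-boundary. -/
theorem exists_d_eq [CharZero k] (h : IsFilteredModelUpTo M D α m) (i : ℕ) (hi : i + 1 ≤ m)
    {n : ℕ} {p : ℤ} (x : (free M.Z).obj n (p - 1)) (hx : x ∈ relPart M.dec (· ≤ ·) i n (p - 1))
    (hd : D.d n (p - 1) x = 0) (hα : ∃ s, dS.toDeriv.d n p s = α.map n (p - 1) x) :
    ∃ y ∈ relPart M.dec (· ≤ ·) (i + 1) n p, D.d n p y = x := by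
  induction i generalizing x with
  | zero =>
    have hx0 : x ∈ tjPart M.dec 0 n (p - 1) :=
      (iSup₂_le fun l hl => by
        obtain rfl : l = 0 := by omega
        exact le_rfl : relPart M.dec (· ≤ ·) 0 n (p - 1) ≤ _) hx
    -- The class of `α x` is both `ρ x` and `0`, hence `ρ x = 0`, and `x` is a `d`-boundary from
    -- weight `1`, where `D` and `d` agree.
    have hcl := sub_mem (h.mem_clGraph hx0) ((dS.mem_clGraph_zero (p := p) (by omega)).2 hα)
    rw [Prod.mk_sub_mk, sub_self, sub_zero] at hcl
    obtain ⟨y, hy, hyx⟩ := M.exact_zero hx0 (dS.eq_zero_of_mem_clGraph hcl)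
    exact ⟨y, tjPart_le_relPart (R := (· ≤ ·)) le_rfl _ _ hy,
      (h.eq_of_lt_two hi (by omega) hy).trans hyx⟩
  | succ i ih =>
    have hle : relPart M.dec (· ≤ ·) (i + 1) n (p - 1) ≤
        tjPart M.dec (i + 1) n (p - 1) ⊔ relPart M.dec (· ≤ ·) i n (p - 1) := by
      refine iSup₂_le fun l hl => ?_
      rcases hl.lt_or_eq with hl | rfl
      · exact (tjPart_le_relPart (R := (· ≤ ·)) (Nat.lt_succ_iff.1 hl) _ _).trans le_sup_right
      · exact le_sup_left
    obtain ⟨x₁, hx₁, x₂, hx₂, rfl⟩ := Submodule.mem_sup.1 (hle hx)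
    -- From `D (x₁ + x₂) = 0` one gets `d x₁ = -((D - d) x₁ + D x₂)`. The left side has weight `i`
    -- and the right side only weights below `i`, so the projection to weight `i` shows that both
    -- vanish.
    have hd₁ : M.d.toDeriv.d n (p - 1) x₁ = 0 := by
      obtain ⟨π, -, hπ, hπ'⟩ := exists_proj M.dec i n (p - 1 - 1)
      have hker : relPart M.dec (fun l j => l + 1 ≤ j) i n (p - 1 - 1) ≤ LinearMap.ker π :=
        iSup₂_le fun l hl y hy => hπ' l (by omega) y hy
      rw [← hπ _ (M.d_mem_tjPart hx₁)]
      refine hker ?_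
      have : M.d.toDeriv.d n (p - 1) x₁ = -((D.d n (p - 1) x₁ - M.d.toDeriv.d n (p - 1) x₁) +
          D.d n (p - 1) x₂) := by
        rw [map_add] at hd
        rw [sub_add_eq_add_sub, hd, zero_sub, neg_neg]
      rw [this]
      exact neg_mem (add_mem
        (relPart_mono (fun l hl => by omega) _ _ (h.d_sub_d_mem (by omega) hx₁))
        (h.d_mem_of_le (by omega) hx₂))
    obtain ⟨y, hy, hyx⟩ := M.exact_succ hx₁ hd₁
    have hym : y ∈ relPart M.dec (· ≤ ·) m n p := tjPart_le_relPart (R := (· ≤ ·)) hi _ _ hy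
    obtain ⟨s, hs⟩ := hα
    -- As `d y = x₁`, subtracting `D y` removes the top weight; the new cycle has image bounded by
    -- `s - α y`.
    obtain ⟨y', hy', hyx'⟩ := ih (by omega) (x₁ + x₂ - D.d n p y)
      (by
        have : x₁ + x₂ - D.d n p y = x₂ - (D.d n p y - M.d.toDeriv.d n p y) := by
          rw [hyx]
          abel
        rw [this]
        exact sub_mem hx₂ (relPart_mono (fun l hl => by omega) _ _ (h.d_sub_d_mem hi hy)))
      (by rw [map_sub, hd, h.d_d_eq_zero hym, sub_zero])
      ⟨s - α.map n p y, by rw [map_sub, map_sub, hs, h.map_d_eq hym]⟩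
    refine ⟨y + y', add_mem (tjPart_le_relPart (R := (· ≤ ·)) le_rfl _ _ hy)
      (relPart_mono (fun l hl => by omega) _ _ hy'), ?_⟩
    rw [map_add, hyx']
    abel

end IsFilteredModelUpTo
end Stage
-- Extension to the next weight and passage to the limit
section Extension

variable {k : Type u} [Field k] {S : Operad.{u, v} k} {dS : S.Differential}
  {M : TJModel.{u, v, w} dS.homology}

namespace IsFilteredModelUpTo

variable {D : (free M.Z).Deriv} {α : (free M.Z).Hom S} {m : ℕ}

/-- `D` sends generators of weight at most `m` to words of such weights, so all the conditions
involve only the values on these generators. -/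
theorem congr (h : IsFilteredModelUpTo M D α m) {D' : (free M.Z).Deriv} {α' : (free M.Z).Hom S}
    (hD : ∀ j ≤ m, ∀ n p, ∀ z ∈ M.dec.piece j n p,
      D'.d n p (gen M.Z n p z) = D.d n p (gen M.Z n p z))
    (hα : ∀ j ≤ m, ∀ n p, ∀ z ∈ M.dec.piece j n p,
      α'.map n p (gen M.Z n p z) = α.map n p (gen M.Z n p z)) :
    IsFilteredModelUpTo M D' α' m := by
  have hmem : ∀ j ≤ m, ∀ n p, ∀ z ∈ M.dec.piece j n p,
      D.d n p (gen M.Z n p z) ∈ ⨆ l, ⨆ _ : l ≤ m, tjPart M.dec l n (p - 1) :=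
    fun j hj n p z hz => relPart_mono (R' := (· ≤ ·)) (j' := m) (fun l hl => by omega) _ _
      (h.d_mem hj (Submodule.subset_span (IsWord.gen z hz)))
  have hD' : ∀ n p, ⨆ l, ⨆ _ : l ≤ m, tjPart M.dec l n p ≤
      LinearMap.eqLocus (D'.d n p) (D.d n p) := fun n p =>
    iSup₂_le fun l hl x hx => D'.eqOn_tjPart D hD hl hx
  have hα' : ∀ n p, ⨆ l, ⨆ _ : l ≤ m, tjPart M.dec l n p ≤
      LinearMap.eqLocus (α'.map n p) (α.map n p) := fun n p =>
    iSup₂_le fun l hl x hx => α'.eqOn_tjPart α hα hl hx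
  refine ⟨fun j hj n p z hz => ?_, fun j hj n p z hz => ?_, fun j hj n p z hz => ?_,
    fun n p z hz => ?_⟩
  · rw [hD j hj n p z hz]
    exact h.lower j hj n p z hz
  · rw [hD j hj n p z hz, hD' n (p - 1) (hmem j hj n p z hz)]
    exact h.d_d j hj n p z hz
  · rw [hD j hj n p z hz, hα' n (p - 1) (hmem j hj n p z hz), hα j hj n p z hz]
    exact h.map_d j hj n p z hz
  · rw [hα 0 (Nat.zero_le m) n p z hz]
    exact h.cl_eq n p z hz

/-- The possible values of the differential and of the map to `S` on a generator of weight
`m + 1`. -/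
theorem exists_extension_at [CharZero k] (h : IsFilteredModelUpTo M D α m) {n : ℕ} {p : ℤ}
    {z : M.Z.obj n p} (hz : z ∈ M.dec.piece (m + 1) n p) :
    ∃ (y : (free M.Z).obj n (p - 1)) (s : S.obj n p),
      y - M.d.toDeriv.d n p (gen M.Z n p z) ∈
        relPart M.dec (fun l j => l + 2 ≤ j) (m + 1) n (p - 1) ∧
      D.d n (p - 1) y = 0 ∧ α.map n (p - 1) y = dS.toDeriv.d n p s := by
  obtain ⟨c, hc⟩ : ∃ c, c = M.d.toDeriv.d n p (gen M.Z n p z) := ⟨_, rfl⟩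
  rw [← hc]
  have hcm : c ∈ tjPart M.dec m n (p - 1) := hc ▸ M.d_succ m n p _ _ z hz
  have hρc : M.ρ.map n (p - 1) c = 0 := hc ▸ M.ρ_d n p _
  have hdc : M.d.toDeriv.d n (p - 1) c = 0 := hc ▸ M.d.d_d _ _ _ _ _ _ _
  have hcle : c ∈ relPart M.dec (· ≤ ·) m n (p - 1) :=
    tjPart_le_relPart (R := (· ≤ ·)) le_rfl _ _ hcm
  cases m with
  | zero =>
    -- For a generator of weight `1` no correction is needed: the class of `α c` is `ρ c = 0`.
    have h0 := h.mem_clGraph hcm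
    rw [hρc] at h0
    obtain ⟨s, hs⟩ := (dS.mem_clGraph_zero (p := p) (by omega)).1 h0
    refine ⟨c, s, by rw [sub_self]; exact zero_mem _, ?_, hs.symm⟩
    rw [h.eq_of_lt_two le_rfl (by omega) hcm, hdc]
  | succ m =>
    obtain ⟨y, hy, hyc⟩ : ∃ y ∈ relPart M.dec (· ≤ ·) m n (p - 1),
        D.d n (p - 1) (c - y) = 0 := by
      cases m with
      | zero =>
        -- Here `c` has weight `1`, where `D` and `d` agree, so it is already a `D`-cycle.
        refine ⟨0, zero_mem _, ?_⟩
        rw [sub_zero, h.eq_of_lt_two le_rfl (by omega) hcm, hdc]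
      | succ i =>
        have hDc := h.d_sub_d_mem le_rfl hcm
        rw [hdc, sub_zero] at hDc
        -- Since `d c = 0`, the element `D c = (D - d) c` has weights at most `i`, two below that of
        -- `c`; its primitive `y` then has weights at most `i + 1`, which is what the condition on
        -- `z` allows.
        obtain ⟨y, hy, hyD⟩ := h.exists_d_eq i (by omega) (D.d n (p - 1) c)
          (relPart_mono (fun l hl => by omega) _ _ hDc) (h.d_d_eq_zero hcle)
          ⟨α.map n (p - 1) c, (h.map_d_eq hcle).symm⟩
        exact ⟨y, hy, by rw [map_sub, hyD, sub_self]⟩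
    have hcy : c - y ∈ relPart M.dec (· ≤ ·) (m + 1) n (p - 1) :=
      sub_mem hcle (relPart_mono (fun l hl => by omega) _ _ hy)
    have hcyc : α.map n (p - 1) (c - y) ∈ dS.cycles n (p - 1) := by
      have := h.map_d_eq hcy
      rw [hyc, map_zero] at this
      exact this.symm
    -- The homology class of `α (c - y)` is an obstruction, cancelled by a weight-zero `x`. Such a
    -- correction is permitted because `z` now has weight at least `2`, and `D x = 0` keeps `c - y -
    -- x` a cycle.
    obtain ⟨x, hx, hxc⟩ := M.exists_ρ_eq (dS.cl n (p - 1) ⟨_, hcyc⟩)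
    have hx' := h.mem_clGraph hx
    have h0 := sub_mem (dS.mem_clGraph.2 ⟨hcyc, rfl⟩) hx'
    rw [Prod.mk_sub_mk, hxc, sub_self, ← map_sub] at h0
    obtain ⟨s, hs⟩ := (dS.mem_clGraph_zero (p := p) (by omega)).1 h0
    refine ⟨c - y - x, s, ?_, ?_, hs.symm⟩
    · have : c - y - x - c = -(y + x) := by abel
      rw [this]
      exact neg_mem (add_mem (relPart_mono (fun l hl => by omega) _ _ hy)
        (tjPart_le_relPart (R := fun l j => l + 2 ≤ j) (by omega) _ _ hx))
    · rw [map_sub, hyc, h.eq_of_lt_two (Nat.zero_le _) (by omega) hx, M.d_eq_zero hx, sub_zero]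

theorem exists_succ [CharZero k] (h : IsFilteredModelUpTo M D α m) :
    ∃ (D' : (free M.Z).Deriv) (α' : (free M.Z).Hom S), IsFilteredModelUpTo M D' α' (m + 1) ∧
      (∀ j ≤ m, ∀ n p, ∀ z ∈ M.dec.piece j n p,
        D'.d n p (gen M.Z n p z) = D.d n p (gen M.Z n p z)) ∧
      ∀ j ≤ m, ∀ n p, ∀ z ∈ M.dec.piece j n p,
        α'.map n p (gen M.Z n p z) = α.map n p (gen M.Z n p z) := by
  have hsec : ∀ n p, ∃ f : M.Z.obj n p →ₗ[k] (free M.Z).obj n (p - 1) × S.obj n p,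
      (∀ σ z, f (M.Z.act n p σ z) = ((free M.Z).act n (p - 1)).prod (S.act n p) σ (f z)) ∧
      ∀ z ∈ M.dec.piece (m + 1) n p, (f z).1 - M.d.toDeriv.d n p (gen M.Z n p z) ∈
        relPart M.dec (fun l j => l + 2 ≤ j) (m + 1) n (p - 1) ∧
        D.d n (p - 1) (f z).1 = 0 ∧ α.map n (p - 1) (f z).1 = dS.toDeriv.d n p (f z).2 := by
    intro n p
    -- The requirements on the values `y` of `D` and `s` of `α` at `z` are linear and invariant in
    -- `(z, y, s)`, so the elementwise solutions can be chosen linearly and equivariantly.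
    let R : Submodule k (M.Z.obj n p × ((free M.Z).obj n (p - 1) × S.obj n p)) :=
      (relPart M.dec (fun l j => l + 2 ≤ j) (m + 1) n (p - 1)).comap
          (LinearMap.fst k _ _ ∘ₗ LinearMap.snd k _ _ -
            M.d.toDeriv.d n p ∘ₗ gen M.Z n p ∘ₗ LinearMap.fst k _ _) ⊓
        (LinearMap.ker (D.d n (p - 1) ∘ₗ LinearMap.fst k _ _ ∘ₗ LinearMap.snd k _ _) ⊓
          LinearMap.eqLocus (α.map n (p - 1) ∘ₗ LinearMap.fst k _ _ ∘ₗ LinearMap.snd k _ _)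
            (dS.toDeriv.d n p ∘ₗ LinearMap.snd k _ _ ∘ₗ LinearMap.snd k _ _))
    refine exists_equivariant_section (M.Z.act n p) (((free M.Z).act n (p - 1)).prod (S.act n p))
      (M.dec.piece (m + 1) n p) (fun σ z hz => M.dec.act_mem _ n p σ z hz) R ?_ ?_
    · rintro σ z ⟨y, s⟩ ⟨h1, h2, h3⟩
      refine ⟨?_, ?_, ?_⟩
      · have := act_mem_relPart σ h1
        simpa [← M.d.toDeriv.d_act, ← gen_act] using this
      · replace h2 : D.d n (p - 1) y = 0 := h2
        show D.d n (p - 1) ((free M.Z).act n (p - 1) σ y) = 0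
        rw [D.d_act, h2, map_zero]
      · replace h3 : α.map n (p - 1) y = dS.toDeriv.d n p s := h3
        show α.map n (p - 1) ((free M.Z).act n (p - 1) σ y) = dS.toDeriv.d n p (S.act n p σ s)
        rw [α.map_act, h3, dS.toDeriv.d_act]
    · intro z hz
      obtain ⟨y, s, h1, h2, h3⟩ := h.exists_extension_at hz
      exact ⟨(y, s), h1, h2, h3⟩
  choose f hf hfR using hsec
  choose θ hθ hθ' using fun n p => exists_equivariant_glue (M.Z.act n p)
    ((free M.Z).act n (p - 1)) (M.dec.isInternal n p) (fun j σ x hx => M.dec.act_mem j n p σ x hx)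
    (fun j => if j = m + 1 then LinearMap.fst k _ _ ∘ₗ f n p else D.d n p ∘ₗ gen M.Z n p)
    (fun j σ x => by split_ifs <;> simp [hf, gen_act, D.d_act])
  choose a ha ha' using fun n p => exists_equivariant_glue (M.Z.act n p)
    (S.act n p) (M.dec.isInternal n p) (fun j σ x hx => M.dec.act_mem j n p σ x hx)
    (fun j => if j = m + 1 then LinearMap.snd k _ _ ∘ₗ f n p else α.map n p ∘ₗ gen M.Z n p)
    (fun j σ x => by split_ifs <;> simp [hf, gen_act, α.map_act])
  obtain ⟨D', hD'⟩ : ∃ D', D' = freeDeriv θ hθ := ⟨_, rfl⟩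
  obtain ⟨α', hα'⟩ : ∃ α', α' = freeLift S a ha := ⟨_, rfl⟩
  have hDle : ∀ j ≤ m, ∀ n p, ∀ z ∈ M.dec.piece j n p,
      D'.d n p (gen M.Z n p z) = D.d n p (gen M.Z n p z) := fun j hj n p z hz => by
    rw [hD', freeDeriv_gen, hθ' n p j z hz, if_neg (by omega)]
    rfl
  have hαle : ∀ j ≤ m, ∀ n p, ∀ z ∈ M.dec.piece j n p,
      α'.map n p (gen M.Z n p z) = α.map n p (gen M.Z n p z) := fun j hj n p z hz => by
    rw [hα', freeLift_gen, ha' n p j z hz, if_neg (by omega)]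
    rfl
  have hDeq : ∀ n p, ∀ z ∈ M.dec.piece (m + 1) n p,
      D'.d n p (gen M.Z n p z) = (f n p z).1 := fun n p z hz => by
    rw [hD', freeDeriv_gen, hθ' n p _ z hz, if_pos rfl]
    rfl
  have hαeq : ∀ n p, ∀ z ∈ M.dec.piece (m + 1) n p,
      α'.map n p (gen M.Z n p z) = (f n p z).2 := fun n p z hz => by
    rw [hα', freeLift_gen, ha' n p _ z hz, if_pos rfl]
    rfl
  have hfm : ∀ n p, ∀ z ∈ M.dec.piece (m + 1) n p,
      (f n p z).1 ∈ ⨆ l, ⨆ _ : l ≤ m, tjPart M.dec l n (p - 1) := fun n p z hz => by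
    rw [← sub_add_cancel (f n p z).1 (M.d.toDeriv.d n p (gen M.Z n p z))]
    exact add_mem
      (relPart_mono (R' := (· ≤ ·)) (j' := m) (fun l hl => by omega) _ _ (hfR n p z hz).1)
      (tjPart_le_relPart (R := (· ≤ ·)) le_rfl _ _ (M.d_succ m n p _ _ z hz))
  have h' := h.congr hDle hαle
  have hDm : ∀ n p, ⨆ l, ⨆ _ : l ≤ m, tjPart M.dec l n p ≤
      LinearMap.eqLocus (D'.d n p) (D.d n p) := fun n p =>
    iSup₂_le fun l hl x hx => D'.eqOn_tjPart D hDle hl hx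
  have hαm : ∀ n p, ⨆ l, ⨆ _ : l ≤ m, tjPart M.dec l n p ≤
      LinearMap.eqLocus (α'.map n p) (α.map n p) := fun n p =>
    iSup₂_le fun l hl x hx => α'.eqOn_tjPart α hαle hl hx
  refine ⟨D', α', ⟨fun j hj n p z hz => ?_, fun j hj n p z hz => ?_, fun j hj n p z hz => ?_,
    h'.cl_eq⟩, hDle, hαle⟩
  all_goals
    rcases Nat.lt_or_eq_of_le hj with hj | rfl
  · exact h'.lower j (by omega) n p z hz
  · rw [hDeq n p z hz]
    exact (hfR n p z hz).1
  · exact h'.d_d j (by omega) n p z hz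
  · rw [hDeq n p z hz, hDm n (p - 1) (hfm n p z hz)]
    exact (hfR n p z hz).2.1
  · exact h'.map_d j (by omega) n p z hz
  · rw [hDeq n p z hz, hαm n (p - 1) (hfm n p z hz), hαeq n p z hz]
    exact (hfR n p z hz).2.2

end IsFilteredModelUpTo

variable (M)

/-- Equivariant cycle representatives of the classes `ρ z`, together with `D = 0`; the values on
generators of positive weight are provisional and are replaced at later stages. -/
theorem exists_isFilteredModelUpTo_zero [CharZero k] :
    ∃ (D : (free M.Z).Deriv) (α : (free M.Z).Hom S), IsFilteredModelUpTo M D α 0 := by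
  choose a ha ha' using fun n p => exists_equivariant_section (M.Z.act n p) (S.act n p) ⊤
    (fun _ _ _ => trivial)
    ((dS.clGraph n p).comap (LinearMap.prod (LinearMap.snd k _ _)
      (M.ρ.map n p ∘ₗ gen M.Z n p ∘ₗ LinearMap.fst k _ _)))
    (fun σ x y hxy => by
      have := dS.act_mem_clGraph σ hxy
      show (S.act n p σ y, M.ρ.map n p (gen M.Z n p (M.Z.act n p σ x))) ∈ dS.clGraph n p
      rw [gen_act, M.ρ.map_act]
      exact this)
    (fun x _ => by
      obtain ⟨y, hy⟩ := Submodule.Quotient.mk_surjective _ (M.ρ.map n p (gen M.Z n p x))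
      exact ⟨y.1, dS.mem_clGraph.2 ⟨y.2, hy⟩⟩)
  refine ⟨freeDeriv (fun _ _ => 0) (by simp), freeLift S a ha, ?_, ?_, ?_, ?_⟩
  · intro j hj n p z hz
    obtain rfl : j = 0 := by omega
    have : M.d.toDeriv.d n p (gen M.Z n p z) = 0 := M.d_zero n p _ _ z hz
    rw [freeDeriv_gen, this]
    simp
  · intro j hj n p z hz
    rw [freeDeriv_gen]
    simp
  · intro j hj n p z hz
    rw [freeDeriv_gen, freeLift_gen]
    obtain ⟨hs, -⟩ := dS.mem_clGraph.1 (ha' n p z trivial)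
    exact (map_zero _).trans (hs : dS.toDeriv.d n p (a n p z) = 0).symm
  · intro n p z hz
    exact ha' n p z trivial

theorem exists_isFilteredModelUpTo [CharZero k] :
    ∃ (D : (free M.Z).Deriv) (α : (free M.Z).Hom S), ∀ m, IsFilteredModelUpTo M D α m := by
  obtain ⟨D₀, α₀, h₀⟩ := exists_isFilteredModelUpTo_zero M
  choose D₁ α₁ h₁ hD₁ hα₁ using fun (m : ℕ) (D : (free M.Z).Deriv) (α : (free M.Z).Hom S)
    (h : IsFilteredModelUpTo M D α m) => h.exists_succ
  let s : ∀ m, {x : (free M.Z).Deriv × (free M.Z).Hom S // IsFilteredModelUpTo M x.1 x.2 m} :=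
    fun m => Nat.rec ⟨(D₀, α₀), h₀⟩
      (fun m x => ⟨(D₁ m x.1.1 x.1.2 x.2, α₁ m x.1.1 x.1.2 x.2), h₁ m _ _ x.2⟩) m
  have hD : ∀ j m, j ≤ m → ∀ n p, ∀ z ∈ M.dec.piece j n p,
      (s m).1.1.d n p (gen M.Z n p z) = (s j).1.1.d n p (gen M.Z n p z) := by
    intro j m hjm n p z hz
    induction m, hjm using Nat.le_induction with
    | base => rfl
    | succ m hm ih => exact (hD₁ m _ _ (s m).2 j hm n p z hz).trans ih
  have hα : ∀ j m, j ≤ m → ∀ n p, ∀ z ∈ M.dec.piece j n p,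
      (s m).1.2.map n p (gen M.Z n p z) = (s j).1.2.map n p (gen M.Z n p z) := by
    intro j m hjm n p z hz
    induction m, hjm using Nat.le_induction with
    | base => rfl
    | succ m hm ih => exact (hα₁ m _ _ (s m).2 j hm n p z hz).trans ih
  -- The limit takes its values on weight `j` from stage `j`; as later stages do not change them, it
  -- agrees with stage `m` on all weights at most `m`.
  choose θ hθ hθ' using fun n p => exists_equivariant_glue (M.Z.act n p)
    ((free M.Z).act n (p - 1)) (M.dec.isInternal n p) (fun j σ x hx => M.dec.act_mem j n p σ x hx)
    (fun j => (s j).1.1.d n p ∘ₗ gen M.Z n p)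
    (fun j σ x => by simp [gen_act, (s j).1.1.d_act])
  choose a ha ha' using fun n p => exists_equivariant_glue (M.Z.act n p)
    (S.act n p) (M.dec.isInternal n p) (fun j σ x hx => M.dec.act_mem j n p σ x hx)
    (fun j => (s j).1.2.map n p ∘ₗ gen M.Z n p)
    (fun j σ x => by simp [gen_act, (s j).1.2.map_act])
  refine ⟨freeDeriv θ hθ, freeLift S a ha, fun m => (s m).2.congr ?_ ?_⟩
  · intro j hj n p z hz
    rw [freeDeriv_gen, hθ' n p j z hz, hD j m hj n p z hz]
    rfl
  · intro j hj n p z hz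
    rw [freeLift_gen, ha' n p j z hz, hα j m hj n p z hz]
    rfl

end Extension

/-! ### From derivations of square zero to differentials -/

section Differential

variable {k : Type u} [Field k] {S : Operad.{u, v} k}

/-- A derivation of square zero as a differential. -/
def Operad.Deriv.toDifferential (D : S.Deriv)
    (hD : ∀ n p x, D.d n (p - 1) (D.d n p x) = 0) : S.Differential where
  d n p q h := Eq.rec (motive := fun q _ => S.obj n p →ₗ[k] S.obj n q) (D.d n p)
    (by omega : p - 1 = q)
  d_act n p q h σ x := by
    obtain rfl : q = p - 1 := by omega
    exact D.d_act ..
  d_circ e i p q r p' q' r' hr hp hq hr' x y := by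
    obtain rfl : p' = p - 1 := by omega
    obtain rfl : q' = q - 1 := by omega
    obtain rfl : r' = r - 1 := by omega
    exact D.d_circ ..
  d_d n p q r hq hr x := by
    obtain rfl : q = p - 1 := by omega
    obtain rfl : r = p - 1 - 1 := by omega
    exact hD ..

end Differential

end OperadModels

/-! ### The filtered model and its quasi-isomorphism -/

open OperadModels
theorem mainTheorem5 {k : Type u} [Field k] [CharZero k] (S : Operad.{u, v} k)
    (hS : S.Reduced) (dS : S.Differential) (M : TJModel.{u, v, w} dS.homology) :
    ∃ (D : (free M.Z).Differential) (α : DGHom D dS),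
      (∀ j n p q (h : q + 1 = p), ∀ z ∈ M.dec.piece j n p,
        D.d n p q h (gen M.Z n p z) - M.d.d n p q h (gen M.Z n p z) ∈
          ⨆ l : ℕ, ⨆ _ : l + 2 ≤ j, tjPart M.dec l n q) ∧
      ∀ n p, Function.Bijective (α.homologyHom.map n p) := by
  obtain ⟨D, α, h⟩ := exists_isFilteredModelUpTo M
  -- Every element involves finitely many weights, so each identity can be checked at a finite
  -- stage.
  have exists_le : ∀ {n : ℕ} {p : ℤ} (x : (free M.Z).obj n p),
      ∃ m, x ∈ relPart M.dec (· ≤ ·) m n p := by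
    intro n p x
    have hx : x ∈ ⨆ m, relPart M.dec (· ≤ ·) m n p := by
      have : (⊤ : Submodule k ((free M.Z).obj n p)) ≤ ⨆ m, relPart M.dec (· ≤ ·) m n p := by
        rw [← iSup_tjPart M.dec n p]
        exact iSup_mono fun j => tjPart_le_relPart (R := (· ≤ ·)) le_rfl n p
      exact this Submodule.mem_top
    exact (Submodule.mem_iSup_of_directed _ (directed_of_isDirected_le fun i j hij =>
      relPart_mono (fun l hl => hl.trans hij) n p)).1 hx
  have hDD : ∀ n p x, D.d n (p - 1) (D.d n p x) = 0 := fun n p x => by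
    obtain ⟨m, hx⟩ := exists_le x
    exact (h m).d_d_eq_zero hx
  have hαD : ∀ n p x, α.map n (p - 1) (D.d n p x) = dS.toDeriv.d n p (α.map n p x) :=
    fun n p x => by
      obtain ⟨m, hx⟩ := exists_le x
      exact (h m).map_d_eq hx
  let α' : DGHom (D.toDifferential hDD) dS :=
    { α with
      map_d := fun n p q e x => by
        obtain rfl : q = p - 1 := by omega
        exact hαD n p x }
  refine ⟨D.toDifferential hDD, α', fun j n p q e z hz => ?_, fun n p => ⟨?_, fun c => ?_⟩⟩
  · obtain rfl : q = p - 1 := by omega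
    exact (h j).lower j le_rfl n p z hz
  · refine (injective_iff_map_eq_zero _).2 fun c hc => ?_
    obtain ⟨x, rfl⟩ := Submodule.Quotient.mk_surjective _ c
    obtain ⟨p, rfl⟩ : ∃ p', p = p' - 1 := ⟨p + 1, by omega⟩
    obtain ⟨m, hx⟩ := exists_le x.1
    -- Injectivity: the primitive of a cycle of weights at most `m` may need weight `m + 1`, hence
    -- stage `m + 1`.
    obtain ⟨y, -, hy⟩ := (h (m + 1)).exists_d_eq m le_rfl x.1 hx x.2
      ((dS.cl_eq_zero_iff (p := p) (by omega)).1 hc)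
    exact ((D.toDifferential hDD).cl_eq_zero_iff (p := p) (by omega)).2 ⟨y, hy⟩
  -- Surjectivity: a weight-zero `x` over `c` is a `D`-cycle, and the class of `α x` is `ρ x = c`.
  · obtain ⟨x, hx, rfl⟩ := M.exists_ρ_eq c
    have hxc : D.d n p x = 0 := by
      rw [(h 0).eq_of_lt_two le_rfl (by omega) hx, M.d_eq_zero hx]
    obtain ⟨hs, hs'⟩ := dS.mem_clGraph.1 ((h 0).mem_clGraph hx)
    exact ⟨(D.toDifferential hDD).cl n p ⟨x, hxc⟩, hs'⟩
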